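/- Let $k\in\frac12\mathbb Z$, $\Gamma=\mathrm{SL}_2(\mathbb Z)$, $S=\left(\begin{smallmatrix}0&-1\\1&0\end{smallmatrix}\right)$, $T=\left(\begin{smallmatrix}1&1\\0&1\end{smallmatrix}\right)$; complex powers are principal values. Let $\chi:\Gamma\to\mathbb C$ be a unitary multiplier system of weight $k$, i.e. $|\chi(\gamma)|=1$ and $\chi(\gamma_1\gamma_2)\,j(\gamma_1\gamma_2,\tau)^k=\chi(\gamma_1)\chi(\gamma_2)\,j(\gamma_1,\gamma_2\tau)^k j(\gamma_2,\tau)^k$ for all $\gamma_1,\gamma_2\in\Gamma$ and $\tau\in\mathbb H$, where $j\left(\left(\begin{smallmatrix}a&b\\c&d\end{smallmatrix}\right),\tau\right)=c\tau+d$. Let $\rho:\Gamma\to \mathrm{GL}(m,\mathbb C)$ be a unitary representation, and let $\kappa_j\in[0,1)$ $(1\le j\le m)$ satisfy $\chi(T)\rho(T)\mathbf e_j=e^{2\pi i\kappa_j}\mathbf e_j$. Write $\tau=u+iv\in\mathbb H$ and $\Gamma(a,w)=\int_w^\infty e^{-t}t^{a-1}\,dt$ for $w>0$. The space $H_{k,\chi,\rho}$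 of vector-valued harmonic weak Maass forms consists of the real-analytic $f:\mathbb H\to\mathbb C^m$ such that (1) $(c\tau+d)^{-k}\chi(\gamma)^{-1}\rho(\gamma)^{-1}f(\gamma\tau)=f(\tau)$ for all $\gamma=\left(\begin{smallmatrix}a&b\\c&d\end{smallmatrix}\right)\in\Gamma$; (2) $\Delta_kf=0$, where $\Delta_k=-4v^2\frac{\partial}{\partial\tau}\frac{\partial}{\partial\bar\tau}+2kiv\frac{\partial}{\partial\bar\tau}$; (3) for some $n_0\in\mathbb N$ and some coefficients $c^\pm_{f,j}(n)\in\mathbb C$, $f$ has an absolutely convergent expansion $$f(\tau)=\sum_{j=1}^m\sum_{n\ge -n_0}c^+_{f,j}(n)e^{2\pi i(n+\kappa_j)\tau}\mathbf e_j+\sum_{j=1}^m\sum_{n+\kappa_j<0}c^-_{f,j}(n)\,\Gamma(1-k,-4\pi(n+\kappa_j)v)\,e^{2\pi i(n+\kappa_j)\tau}\mathbf e_j.\qquad(*)$$ For a function $\varphi$ on $\mathbb R_+=(0,\infty)$ put $(\mathcal L\varphi)(s)=\int_0^\infty e^{-st}\varphi(t)\,dt$, $\varphi_s(x)=\varphi(x)x^{s-1}$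 and $(\varphi|_{2-k,\chi^{-1}}S)(x)=x^{k-2}\chi(S)\varphi(1/x)$. Let $S_c(\mathbb R_+)$ be a set of complex-valued, compactly supported, piecewise smooth functions on $\mathbb R_+$ (the value at a break point being one of the two one-sided limits) such that for every $y>0$ some $\varphi\in S_c(\mathbb R_+)$ has $\varphi(y)\ne0$, and such that $\varphi_s\in S_c(\mathbb R_+)$ whenever $\varphi\in S_c(\mathbb R_+)$ and $s\in\mathbb C$; for instance, the set of all such functions. **Theorem.** Let $n_0\in\mathbb N$. For each $1\le j\le m$ let $(c^+_{f,j}(n))_{n\ge -n_0}$ and $(c^-_{f,j}(n))_{n+\kappa_j<0}$ be sequences of complex numbers with $c^\pm_{f,j}(n)=O(e^{C\sqrt{|n|}})$ as $|n|\to\infty$, for some $C>0$, and let $f$ be the function on $\mathbb H$ given by $(*)$. For a compactly supported, piecewise smooth function $\varphi$ on $\mathbb R_+$ set $$L_f(\varphi)=\sum_{j=1}^m\Big(\sum_{n\ge -n_0}c^+_{f,j}(n)(\mathcal L\varphi)(2\pi(n+\kappa_j))+\sum_{n+\kappa_j<0}c^-_{f,j}(n)(-4\pi(n+\kappa_j))^{1-k}\int_0^\infty\frac{(\mathcal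 L\varphi_{2-k})(-2\pi(n+\kappa_j)(2t+1))}{(1+t)^k}dt\Big)\mathbf e_j$$ and, for $\delta_kf=\tau\frac{\partial f}{\partial u}+\frac k2f$, $$L_{\delta_kf}(\varphi)=\tfrac k2L_f(\varphi)-2\pi\sum_{j=1}^m\Big(\sum_{n\ge -n_0}c^+_{f,j}(n)(n+\kappa_j)(\mathcal L\varphi_2)(2\pi(n+\kappa_j))+\sum_{n+\kappa_j<0}c^-_{f,j}(n)(n+\kappa_j)(-4\pi(n+\kappa_j))^{1-k}\int_0^\infty\frac{(\mathcal L\varphi_{3-k})(-2\pi(n+\kappa_j)(2t+1))}{(1+t)^k}dt\Big)\mathbf e_j.$$ Suppose that for every $\varphi\in S_c(\mathbb R_+)$ $$L_f(\varphi)=i^k\rho(S)L_f(\varphi|_{2-k,\chi^{-1}}S)\quad\text{and}\quad L_{\delta_kf}(\varphi)=-i^k\rho(S)L_{\delta_kf}(\varphi|_{2-k,\chi^{-1}}S).$$ Then $f\in H_{k,\chi,\rho}$. -/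

import Mathlib

open scoped ContDiff Topology MatrixGroups UpperHalfPlane

noncomputable section

namespace VVMaass

/-! ### Multiplier systems and the slash operator

All complex powers are principal values, `z ^ s = exp (s * log z)` with `-π < arg z ≤ π`. -/

/-- The factor `(c τ + d) ^ k`. -/
def autFactor (k : ℝ) (γ : SL(2, ℤ)) (τ : ℍ) : ℂ :=
  (((γ 1 0 : ℤ) : ℂ) * (τ : ℂ) + ((γ 1 1 : ℤ) : ℂ)) ^ (k : ℂ)

/-- `χ` is a unitary multiplier system of weight `k` on `SL(2, ℤ)`. -/
structure IsMultiplierSystem (k : ℝ) (χ : SL(2, ℤ) → ℂ) : Prop where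
  norm_eq_one : ∀ γ, ‖χ γ‖ = 1
  consistency : ∀ (γ₁ γ₂ : SL(2, ℤ)) (τ : ℍ),
    χ (γ₁ * γ₂) * autFactor k (γ₁ * γ₂) τ =
      χ γ₁ * χ γ₂ * autFactor k γ₁ (γ₂ • τ) * autFactor k γ₂ τ

/-- The slash operator
`(f |_{k,χ,ρ} γ)(τ) = (c τ + d) ^ (-k) χ(γ)⁻¹ ρ(γ)⁻¹ f (γ τ)`. -/
def slash {m : ℕ} (k : ℝ) (χ : SL(2, ℤ) → ℂ) (ρ : SL(2, ℤ) →* Matrix.unitaryGroup (Fin m) ℂ)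
    (f : ℍ → Fin m → ℂ) (γ : SL(2, ℤ)) (τ : ℍ) : Fin m → ℂ :=
  (autFactor (-k) γ τ * (χ γ)⁻¹) •
    Matrix.mulVec ((ρ γ)⁻¹ : Matrix.unitaryGroup (Fin m) ℂ).1 (f (γ • τ))

/-! ### The hyperbolic Laplacian -/

/-- `∂/∂τ = (∂/∂u - i ∂/∂v) / 2` for `τ = u + i v`. -/
def dTau {m : ℕ} (F : ℂ → Fin m → ℂ) (z : ℂ) : Fin m → ℂ :=
  (1 / 2 : ℂ) • (fderiv ℝ F z 1 - Complex.I • fderiv ℝ F z Complex.I)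

/-- `∂/∂τ̄ = (∂/∂u + i ∂/∂v) / 2` for `τ = u + i v`. -/
def dTauBar {m : ℕ} (F : ℂ → Fin m → ℂ) (z : ℂ) : Fin m → ℂ :=
  (1 / 2 : ℂ) • (fderiv ℝ F z 1 + Complex.I • fderiv ℝ F z Complex.I)

/-- The weight `k` hyperbolic Laplacian
`Δ_k = -4 v² ∂/∂τ ∂/∂τ̄ + 2 k i v ∂/∂τ̄`. -/
def laplacian {m : ℕ} (k : ℝ) (F : ℂ → Fin m → ℂ) (z : ℂ) : Fin m → ℂ :=
  (-4 * (z.im : ℂ) ^ 2) • dTau (dTauBar F) z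
    + (2 * (k : ℂ) * Complex.I * (z.im : ℂ)) • dTauBar F z

/-! ### Fourier expansions -/

/-- The incomplete gamma function `Γ(a, w) = ∫_w^∞ e^{-t} t^{a-1} dt`
(used for `w > 0`, where the integral converges for every real `a`). -/
def incGamma (a w : ℝ) : ℝ :=
  ∫ t in Set.Ioi w, Real.exp (-t) * t ^ (a - 1)

/-- `c e^{2πi (n + κ) τ}`. -/
def holTerm (κ : ℝ) (c : ℤ → ℂ) (τ : ℍ) (n : ℤ) : ℂ :=
  c n * Complex.exp (2 * Real.pi * Complex.I * ((n : ℂ) + (κ : ℂ)) * (τ : ℂ))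

/-- `c Γ(1 - k, -4π (n + κ) v) e^{2πi (n + κ) τ}`. -/
def nonholTerm (k κ : ℝ) (c : ℤ → ℂ) (τ : ℍ) (n : ℤ) : ℂ :=
  c n * (incGamma (1 - k) (-4 * Real.pi * ((n : ℝ) + κ) * τ.im) : ℂ) *
    Complex.exp (2 * Real.pi * Complex.I * ((n : ℂ) + (κ : ℂ)) * (τ : ℂ))

/-- The function on the upper half plane with `j`-th component
`∑_{n ≥ -n₀} c⁺_j(n) e^{2πi (n + κ_j) τ}
  + ∑_{n + κ_j < 0} c⁻_j(n) Γ(1 - k, -4π (n + κ_j) v) e^{2πi (n + κ_j) τ}`. -/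
def maassSeries {m : ℕ} (k : ℝ) (κ : Fin m → ℝ) (n₀ : ℕ) (cp cm : Fin m → ℤ → ℂ)
    (τ : ℍ) : Fin m → ℂ := fun j =>
  (∑' n : {n : ℤ // -(n₀ : ℤ) ≤ n}, holTerm (κ j) (cp j) τ n)
    + ∑' n : {n : ℤ // (n : ℝ) + κ j < 0}, nonholTerm k (κ j) (cm j) τ n

/-- `f` belongs to `H_{k,χ,ρ}`. The numbers `κ_j ∈ [0, 1)` are those for which
`χ(T) ρ(T) e_j = e^{2πi κ_j} e_j`. -/
structure IsHarmonicWeakMaassForm {m : ℕ} (k : ℝ) (χ : SL(2, ℤ) → ℂ)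
    (ρ : SL(2, ℤ) →* Matrix.unitaryGroup (Fin m) ℂ) (κ : Fin m → ℝ)
    (f : ℍ → Fin m → ℂ) : Prop where
  realAnalytic : AnalyticOnNhd ℝ (fun z : ℂ => f (UpperHalfPlane.ofComplex z)) {z | 0 < z.im}
  slash_eq : ∀ γ : SL(2, ℤ), slash k χ ρ f γ = f
  harmonic : ∀ z : ℂ, 0 < z.im →
    laplacian k (fun z : ℂ => f (UpperHalfPlane.ofComplex z)) z = 0
  fourier : ∃ (n₀ : ℕ) (cp cm : Fin m → ℤ → ℂ), ∀ (τ : ℍ),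
    (∀ j, Summable fun n : {n : ℤ // -(n₀ : ℤ) ≤ n} => holTerm (κ j) (cp j) τ n) ∧
    (∀ j, Summable fun n : {n : ℤ // (n : ℝ) + κ j < 0} => nonholTerm k (κ j) (cm j) τ n) ∧
    f τ = maassSeries k κ n₀ cp cm τ

/-! ### Test functions

Functions on `(0, ∞)` with compact support are extended by zero to `ℝ`. -/

/-- `φ_s(x) = φ(x) x^{s-1}`. -/
def twist (φ : ℝ → ℂ) (s : ℂ) (x : ℝ) : ℂ := φ x * (x : ℂ) ^ (s - 1)

/-- `(φ |_{2-k,χ⁻¹} S)(x) = x^{k-2} χ(S) φ(1/x)`. -/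
def testSlash (k : ℝ) (χ : SL(2, ℤ) → ℂ) (φ : ℝ → ℂ) (x : ℝ) : ℂ :=
  ((x ^ (k - 2) : ℝ) : ℂ) * χ ModularGroup.S * φ (1 / x)

/-- Complex-valued, compactly supported, piecewise smooth functions on `(0, ∞)`. Piecewise
smoothness: to the left and to the right of each point, `φ` agrees with a function that is smooth
across the point, and the value of `φ` at the point is one of the two one-sided limits. By
compactness, there are only finitely many break points. -/
structure IsTestFunction (φ : ℝ → ℂ) : Prop where
  compactSupport : HasCompactSupport φ
  support_pos : tsupport φ ⊆ Set.Ioi 0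
  piecewiseSmooth : ∀ x : ℝ, 0 < x → ∃ ε > 0, ∃ g h : ℝ → ℂ,
    ContDiffOn ℝ ∞ g (Set.Ioo (x - ε) (x + ε)) ∧
    ContDiffOn ℝ ∞ h (Set.Ioo (x - ε) (x + ε)) ∧
    (∀ y ∈ Set.Ioo (x - ε) x, φ y = g y) ∧
    (∀ y ∈ Set.Ioo x (x + ε), φ y = h y) ∧
    (φ x = g x ∨ φ x = h x)

/-- A set `S_c(ℝ₊)` of test functions: no point of `(0, ∞)` is a common zero, and
`φ_s` lies in the set whenever `φ` does. -/
structure IsTestSpace (Sc : Set (ℝ → ℂ)) : Prop where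
  isTestFunction : ∀ φ ∈ Sc, IsTestFunction φ
  exists_ne_zero : ∀ y : ℝ, 0 < y → ∃ φ ∈ Sc, φ y ≠ 0
  twist_mem : ∀ φ ∈ Sc, ∀ s : ℂ, twist φ s ∈ Sc

/-- The set of all test functions is a test space. -/
theorem isTestSpace_all : IsTestSpace {φ | IsTestFunction φ} where
  isTestFunction _ h := h
  exists_ne_zero y hy := by
    let b : ContDiffBump y := ⟨y / 4, y / 2, by positivity, by linarith⟩
    refine ⟨fun x => ((b x : ℝ) : ℂ), ⟨?_, ?_, ?_⟩, ?_⟩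
    · exact b.hasCompactSupport.comp_left (g := fun t : ℝ => (t : ℂ)) Complex.ofReal_zero
    · intro x hx
      have hx' : x ∈ tsupport b :=
        tsupport_comp_subset (g := fun t : ℝ => (t : ℂ)) Complex.ofReal_zero b hx
      rw [b.tsupport_eq, Real.closedBall_eq_Icc] at hx'
      have : y - y / 2 ≤ x := hx'.1
      simp only [Set.mem_Ioi]
      linarith
    · intro x _
      have hs : ContDiff ℝ ∞ (fun x => ((b x : ℝ) : ℂ)) :=
        Complex.ofRealCLM.contDiff.comp b.contDiff
      exact ⟨1, one_pos, _, _, hs.contDiffOn, hs.contDiffOn, fun _ _ => rfl, fun _ _ => rfl,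
        Or.inl rfl⟩
    · have : b y = 1 := b.one_of_mem_closedBall (Metric.mem_closedBall_self b.rIn_pos.le)
      simp [this]
  twist_mem φ hφ s := by
    refine ⟨hφ.compactSupport.mul_right, ?_, ?_⟩
    · exact (tsupport_mul_subset_left (f := φ) (g := fun x : ℝ => (x : ℂ) ^ (s - 1))).trans
        hφ.support_pos
    · intro x hx
      obtain ⟨ε, hε, g, h, hg, hh, hgl, hhr, hv⟩ := hφ.piecewiseSmooth x hx
      have hp : ContDiffOn ℝ ∞ (fun y : ℝ => (y : ℂ) ^ (s - 1)) (Set.Ioi 0) := by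
        have : ContDiffOn ℝ ∞ (fun y : ℝ => Complex.exp (((Real.log y : ℝ) : ℂ) * (s - 1)))
            (Set.Ioi 0) := by
          have hl : ContDiffOn ℝ ∞ (fun y : ℝ => ((Real.log y : ℝ) : ℂ)) (Set.Ioi 0) :=
            Complex.ofRealCLM.contDiff.comp_contDiffOn
              (Real.contDiffOn_log.mono fun y (hy : 0 < y) => hy.ne')
          exact (hl.mul contDiffOn_const).cexp
        refine this.congr fun y (hy : 0 < y) => ?_
        rw [Complex.cpow_def_of_ne_zero (by exact_mod_cast hy.ne'), Complex.ofReal_log hy.le]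
      have hsub : Set.Ioo (x - min ε x) (x + min ε x) ⊆ Set.Ioo (x - ε) (x + ε) :=
        Set.Ioo_subset_Ioo (by linarith [min_le_left ε x]) (by linarith [min_le_left ε x])
      have hpos : Set.Ioo (x - min ε x) (x + min ε x) ⊆ Set.Ioi 0 := fun y hy => by
        have := hy.1
        simp only [Set.mem_Ioi]
        linarith [min_le_right ε x]
      refine ⟨min ε x, lt_min hε hx, fun y => g y * (y : ℂ) ^ (s - 1),
        fun y => h y * (y : ℂ) ^ (s - 1), (hg.mono hsub).mul (hp.mono hpos),
        (hh.mono hsub).mul (hp.mono hpos), ?_, ?_, ?_⟩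
      · intro y hy
        simp only [twist]
        rw [hgl y ⟨by linarith [hy.1, min_le_left ε x], hy.2⟩]
      · intro y hy
        simp only [twist]
        rw [hhr y ⟨hy.1, by linarith [hy.2, min_le_left ε x]⟩]
      · rcases hv with hv | hv
        · left; simp only [twist]; rw [hv]
        · right; simp only [twist]; rw [hv]

/-! ### The `L`-series -/

/-- The Laplace transform `(ℒφ)(s) = ∫_0^∞ e^{-st} φ(t) dt`. -/
def laplace (φ : ℝ → ℂ) (s : ℂ) : ℂ :=
  ∫ t in Set.Ioi (0 : ℝ), Complex.exp (-s * t) * φ t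

/-- `x^{1-k} ∫_0^∞ (ℒψ)(x (2t+1) / 2) (1+t)^{-k} dt`, where `x = -4π (n + κ)`. -/
def nonholKernel (k κ : ℝ) (ψ : ℝ → ℂ) (n : ℤ) : ℂ :=
  (((-4 * Real.pi * ((n : ℝ) + κ)) ^ (1 - k) : ℝ) : ℂ) *
    ∫ t in Set.Ioi (0 : ℝ),
      laplace ψ ((-2 * Real.pi * ((n : ℝ) + κ) * (2 * t + 1) : ℝ) : ℂ) /
        (((1 + t) ^ k : ℝ) : ℂ)

/-- `L_f(φ)`. All series and integrals converge absolutely when `φ` is a test function and the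
coefficients are `O(e^{C√|n|})`. -/
def Lf {m : ℕ} (k : ℝ) (κ : Fin m → ℝ) (n₀ : ℕ) (cp cm : Fin m → ℤ → ℂ)
    (φ : ℝ → ℂ) : Fin m → ℂ := fun j =>
  (∑' n : {n : ℤ // -(n₀ : ℤ) ≤ n},
      cp j n * laplace φ ((2 * Real.pi * (((n : ℤ) : ℝ) + κ j) : ℝ) : ℂ))
    + ∑' n : {n : ℤ // (n : ℝ) + κ j < 0},
      cm j n * nonholKernel k (κ j) (twist φ (2 - k)) n

/-- `L_{δ_k f}(φ)`, where `δ_k f = τ ∂f/∂u + (k/2) f`. -/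
def Ldeltaf {m : ℕ} (k : ℝ) (κ : Fin m → ℝ) (n₀ : ℕ) (cp cm : Fin m → ℤ → ℂ)
    (φ : ℝ → ℂ) : Fin m → ℂ := fun j =>
  ((k : ℂ) / 2) * Lf k κ n₀ cp cm φ j
    - 2 * Real.pi * (∑' n : {n : ℤ // -(n₀ : ℤ) ≤ n},
      cp j n * ((((n : ℤ) : ℝ) + κ j : ℝ) : ℂ) *
        laplace (twist φ 2) ((2 * Real.pi * (((n : ℤ) : ℝ) + κ j) : ℝ) : ℂ))
    - 2 * Real.pi * (∑' n : {n : ℤ // (n : ℝ) + κ j < 0},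
      cm j n * ((((n : ℤ) : ℝ) + κ j : ℝ) : ℂ) *
        nonholKernel k (κ j) (twist φ (3 - k)) n)

end VVMaass

end

noncomputable section

namespace VVMaass

open MeasureTheory Set Filter

/-! ### The incomplete gamma function on the right half plane -/

/-! Along the imaginary axis the two $L$-series are integrals: $L_f(\varphi)=\int_0^\infty
f(iy)\varphi(y)\,dy$ and $L_{\delta_kf}(\varphi)=\int_0^\infty(\delta_kf)(iy)\varphi(y)\,dy$
(`Lf_eq_integral`, `Ldeltaf_eq_integral`). The substitution $y\mapsto 1/y$ moves the slash from
$\varphi$ to $f$, and a test space separates continuous functions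
(`IsTestSpace.eq_zero_of_integral_eq_zero`). The functional equations therefore say that
$f(-1/z)=z^kMf(z)$, with $M=\chi(S)\rho(S)$, holds at $z=iy$, and that its derivative in the
direction $u$ holds there too.

For a holomorphic $f$ the first statement would suffice, by the identity theorem. Here $\partial
f/\partial\bar\tau=v^{-k}H(-\bar\tau)$ with $H$ holomorphic, because
$\frac{d}{dw}\Gamma(1-k,w)=-e^{-w}w^{-k}$. So $\Phi(z)=f(-1/z)-z^kMf(z)$ satisfies
$\partial\Phi/\partial\bar z=v^{-k}z^kP(-\bar z)$ with $P$ holomorphic. Both first partial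
derivatives of $\Phi$ vanish on the axis: the vertical one because $\Phi$ does, the horizontal one
by the equation for $\delta_kf$. Hence $P$ vanishes on the axis, so $P=0$; then $\Phi$ is
holomorphic, vanishes on the axis, and is $0$ (`inversion_formula_of_imaginary_axis`).

The law under $T$ is read off the Fourier expansion, and $S$, $T$ generate the group. Harmonicity
follows from the same formula for $\partial f/\partial\bar\tau$ (`laplacian_eq_zero`). Real
analyticity holds because the nonholomorphic part is $G(\tau,v)$ with $G$ holomorphic in two
variables (`exists_analytic_nonholSeries`). -/

lemma rpow_le_const_mul_exp (p : ℝ) {δ t₀ : ℝ} (hδ : 0 < δ) (ht₀ : 0 < t₀) :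
    ∃ C : ℝ, 0 < C ∧ ∀ t, t₀ ≤ t → t ^ p ≤ C * Real.exp (δ * t) := by
  obtain ⟨N, hN⟩ := exists_nat_ge p
  -- The ratio $t/t_0$ is at least $1$, so its $p$-th power is at most its $N$-th, which a single
  -- term of the exponential series controls. The sign of $p$ plays no role.
  refine ⟨t₀ ^ p * ((N.factorial : ℝ) / (δ * t₀) ^ N), by positivity, fun t ht => ?_⟩
  have htpos : 0 < t := ht₀.trans_le ht
  have h1 : t ^ p = t₀ ^ p * (t / t₀) ^ p := by
    rw [← Real.mul_rpow ht₀.le (by positivity), mul_div_cancel₀ _ ht₀.ne']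
  have h2 : (t / t₀) ^ p ≤ (t / t₀) ^ N := by
    rw [← Real.rpow_natCast]
    exact Real.rpow_le_rpow_of_exponent_le ((one_le_div ht₀).2 ht) hN
  have h3 := Real.pow_div_factorial_le_exp (δ * t) (by positivity) N
  rw [div_le_iff₀ (by positivity)] at h3
  rw [h1, mul_assoc]
  refine mul_le_mul_of_nonneg_left (h2.trans ?_) (by positivity)
  rw [div_mul_eq_mul_div, le_div_iff₀ (by positivity), ← mul_pow]
  calc (t / t₀ * (δ * t₀)) ^ N = (δ * t) ^ N := by congr 1; field_simp
    _ ≤ _ := by rw [mul_comm (N.factorial : ℝ)]; exact h3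

lemma integrableOn_exp_mul_one_add_rpow (p : ℝ) {ε : ℝ} (hε : 0 < ε) :
    IntegrableOn (fun t : ℝ => Real.exp (-ε * t) * (1 + t) ^ p) (Ioi 0) := by
  obtain ⟨C, hC, h⟩ := rpow_le_const_mul_exp p (half_pos hε) one_pos
  refine Integrable.mono' (((integrableOn_exp_mul_Ioi (a := -(ε / 2)) (by linarith) 0).const_mul
    (C * Real.exp (ε / 2)))) ?_ ?_
  · refine ContinuousOn.aestronglyMeasurable (fun t ht => ?_) measurableSet_Ioi
    have : (1 + t) ≠ 0 := by have : 0 < t := ht; positivity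
    exact ContinuousAt.continuousWithinAt (by fun_prop (disch := simp [this]))
  · refine (ae_restrict_iff' measurableSet_Ioi).2 (ae_of_all _ fun t (ht : 0 < t) => ?_)
    rw [Real.norm_of_nonneg (by positivity)]
    calc _ ≤ Real.exp (-ε * t) * (C * Real.exp (ε / 2 * (1 + t))) := by
          gcongr; exact h _ (by linarith)
      _ = C * Real.exp (ε / 2) * Real.exp (-(ε / 2) * t) := by
          rw [mul_left_comm, ← Real.exp_add, mul_assoc, ← Real.exp_add]; ring_nf

/-- The integral `∫_0^∞ e^{-wt} (1+t)^{-k} dt`. -/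
def gammaKernel (k : ℝ) (w : ℂ) : ℂ :=
  ∫ t in Ioi (0 : ℝ), Complex.exp (-w * t) * (((1 + t) ^ (-k) : ℝ) : ℂ)

lemma aestronglyMeasurable_gammaKernel_integrand (p : ℝ) (w : ℂ) :
    AEStronglyMeasurable (fun t : ℝ => Complex.exp (-w * t) * (((1 + t) ^ p : ℝ) : ℂ))
      (volume.restrict (Ioi 0)) := by
  refine ContinuousOn.aestronglyMeasurable (fun t ht => ?_) measurableSet_Ioi
  have : (1 + t) ≠ 0 := by have : 0 < t := ht; positivity
  have h1 : ContinuousAt (fun t : ℝ => (1 + t) ^ p) t := by fun_prop (disch := simp [this])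
  exact ContinuousAt.continuousWithinAt
    (ContinuousAt.mul (by fun_prop) (Complex.continuous_ofReal.continuousAt.comp h1))

lemma norm_gammaKernel_integrand_le (p : ℝ) {ε : ℝ} {w : ℂ} (hw : ε ≤ w.re) {t : ℝ} (ht : 0 < t) :
    ‖Complex.exp (-w * t) * (((1 + t) ^ p : ℝ) : ℂ)‖ ≤ Real.exp (-ε * t) * (1 + t) ^ p := by
  rw [norm_mul, Complex.norm_exp, Complex.norm_real, Real.norm_of_nonneg (by positivity)]
  have : (-w * (t : ℂ)).re = -w.re * t := by simp
  rw [this]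
  gcongr

lemma norm_gammaKernel_le (k : ℝ) {ε : ℝ} (hε : 0 < ε) {w : ℂ} (hw : ε ≤ w.re) :
    ‖gammaKernel k w‖ ≤ ∫ t in Ioi (0 : ℝ), Real.exp (-ε * t) * (1 + t) ^ (-k) :=
  norm_integral_le_of_norm_le (integrableOn_exp_mul_one_add_rpow _ hε)
    ((ae_restrict_iff' measurableSet_Ioi).2
      (ae_of_all _ fun _ ht => norm_gammaKernel_integrand_le _ hw ht))

lemma differentiableAt_gammaKernel (k : ℝ) {w : ℂ} (hw : 0 < w.re) :
    DifferentiableAt ℂ (gammaKernel k) w := by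
  have hε : 0 < w.re / 2 := half_pos hw
  have hs : {z : ℂ | w.re / 2 < z.re} ∈ 𝓝 w :=
    (isOpen_lt continuous_const Complex.continuous_re).mem_nhds
      (show w.re / 2 < w.re by linarith)
  have hint : ∀ p : ℝ, IntegrableOn
      (fun t : ℝ => Complex.exp (-w * t) * (((1 + t) ^ p : ℝ) : ℂ)) (Ioi 0) := fun p =>
    Integrable.mono' (integrableOn_exp_mul_one_add_rpow p hw)
      (aestronglyMeasurable_gammaKernel_integrand p w)
      ((ae_restrict_iff' measurableSet_Ioi).2
      (ae_of_all _ fun _ ht => norm_gammaKernel_integrand_le _ le_rfl ht))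
  have := hasDerivAt_integral_of_dominated_loc_of_deriv_le (𝕜 := ℂ)
    (μ := volume.restrict (Ioi (0 : ℝ))) (x₀ := w) (s := {z : ℂ | w.re / 2 < z.re})
    (F := fun (z : ℂ) (t : ℝ) => Complex.exp (-z * t) * (((1 + t) ^ (-k) : ℝ) : ℂ))
    (F' := fun (z : ℂ) (t : ℝ) => -(t : ℂ) * Complex.exp (-z * t) * (((1 + t) ^ (-k) : ℝ) : ℂ))
    (bound := fun t => Real.exp (-(w.re / 2) * t) * (1 + t) ^ (-k + 1))
    hs (Eventually.of_forall fun z => aestronglyMeasurable_gammaKernel_integrand _ z)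
    (hint _) ?_ ?_ (integrableOn_exp_mul_one_add_rpow _ hε) ?_
  · exact this.2.differentiableAt
  · simp_rw [mul_assoc]
    exact AEStronglyMeasurable.mul (by fun_prop) (aestronglyMeasurable_gammaKernel_integrand _ w)
  · refine (ae_restrict_iff' measurableSet_Ioi).2 (ae_of_all _ fun t (ht : 0 < t) z hz => ?_)
    have h1 := norm_gammaKernel_integrand_le (-k) (le_of_lt hz) ht
    rw [mul_assoc, norm_mul, norm_neg, Complex.norm_real, Real.norm_of_nonneg ht.le,
      Real.rpow_add_one (by positivity)]
    calc _ ≤ (1 + t) * (Real.exp (-(w.re / 2) * t) * (1 + t) ^ (-k)) := by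
          gcongr; linarith
      _ = _ := by ring
  · refine ae_of_all _ fun t z _ => ?_
    have h1 : HasDerivAt (fun z : ℂ => -z * t) (-(t : ℂ)) z := by
      simpa using (hasDerivAt_id z).neg.mul_const (t : ℂ)
    convert! (h1.cexp.mul_const _) using 1
    ring

lemma gammaKernel_ofReal (k x : ℝ) :
    gammaKernel k x = ((∫ t in Ioi (0 : ℝ), Real.exp (-x * t) * (1 + t) ^ (-k) : ℝ) : ℂ) := by
  rw [gammaKernel, ← integral_complex_ofReal]
  simp

/-- Substitute $t\mapsto x(1+t)$. The right-hand side still makes sense for complex $x$ with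
positive real part, and it contains the kernel that occurs in $L_f$. -/
lemma incGamma_eq_integral (k : ℝ) {x : ℝ} (hx : 0 < x) :
    incGamma (1 - k) x = x ^ (1 - k) * Real.exp (-x) *
      ∫ t in Ioi (0 : ℝ), Real.exp (-x * t) * (1 + t) ^ (-k) := by
  have h1 := integral_comp_mul_left_Ioi (fun t => Real.exp (-t) * t ^ (1 - k - 1)) 1 hx
  have h2 := (measurePreserving_add_left volume (1 : ℝ)).setIntegral_preimage_emb
    (measurableEmbedding_addLeft 1) (fun t => Real.exp (-(x * t)) * (x * t) ^ (1 - k - 1)) (Ioi 1)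
  rw [preimage_const_add_Ioi, sub_self] at h2
  rw [← h2, mul_one, smul_eq_mul, ← incGamma, eq_inv_mul_iff_mul_eq₀ hx.ne'] at h1
  rw [← h1, ← integral_const_mul, ← integral_const_mul]
  refine setIntegral_congr_fun measurableSet_Ioi fun t (ht : 0 < t) => ?_
  rw [Real.mul_rpow hx.le (by positivity), show 1 - k - 1 = -k by ring,
    show -(x * (1 + t)) = -x + -x * t by ring, Real.exp_add, sub_eq_add_neg, Real.rpow_add hx,
    Real.rpow_one]
  ring

lemma hasDerivAt_incGamma (a : ℝ) {x : ℝ} (hx : 0 < x) :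
    HasDerivAt (incGamma a) (-(Real.exp (-x) * x ^ (a - 1))) x := by
  have hcont : ContinuousOn (fun t : ℝ => Real.exp (-t) * t ^ (a - 1)) (Ioi 0) := fun t ht =>
    ContinuousAt.continuousWithinAt (by fun_prop (disch := simp [(ne_of_gt ht : t ≠ 0)]))
  have hint : ∀ y, 0 < y → IntegrableOn (fun t : ℝ => Real.exp (-t) * t ^ (a - 1)) (Ioi y) := by
    intro y hy
    obtain ⟨C, hC, h⟩ := rpow_le_const_mul_exp (a - 1) (half_pos one_pos) hy
    refine Integrable.mono' ((integrableOn_exp_mul_Ioi (a := -(1 / 2)) (by norm_num) y).const_mul C)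
      ((hcont.mono (Ioi_subset_Ioi hy.le)).aestronglyMeasurable measurableSet_Ioi) ?_
    refine (ae_restrict_iff' measurableSet_Ioi).2 (ae_of_all _ fun t (ht : y < t) => ?_)
    have := hy.trans ht
    rw [Real.norm_of_nonneg (by positivity)]
    calc _ ≤ Real.exp (-t) * (C * Real.exp (1 / 2 * t)) := by
          gcongr; exact h _ ht.le
      _ = C * Real.exp (-(1 / 2) * t) := by
          rw [mul_left_comm, ← Real.exp_add]; ring_nf
  have hx2 : 0 < x / 2 := half_pos hx
  have h1 : HasDerivAt (fun u => ∫ t in (x / 2)..u, Real.exp (-t) * t ^ (a - 1))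
      (Real.exp (-x) * x ^ (a - 1)) x := by
    refine intervalIntegral.integral_hasDerivAt_right ?_ ?_ (hcont.continuousAt (Ioi_mem_nhds hx))
    · refine ContinuousOn.intervalIntegrable (hcont.mono ?_)
      rw [uIcc_of_le (by linarith)]
      exact fun t ht => hx2.trans_le ht.1
    · exact hcont.stronglyMeasurableAtFilter isOpen_Ioi x hx
  have h2 := h1.const_sub (incGamma a (x / 2))
  refine h2.congr_of_eventuallyEq ?_
  filter_upwards [Ioi_mem_nhds (show x / 2 < x by linarith)] with u hu
  rw [incGamma, incGamma, intervalIntegral.integral_of_le (le_of_lt hu),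
    ← setIntegral_sdiff measurableSet_Ioc (hint _ hx2) (fun t ht => ht.1)]
  congr 2
  ext t
  simp only [mem_Ioi, Set.mem_sdiff, mem_Ioc, not_and, not_le]
  exact ⟨fun h => ⟨lt_trans hu h, fun _ => h⟩, fun h => h.2 h.1⟩

/-- The holomorphic extension of `w ↦ Γ(1 - k, w)` to the right half plane. -/
def cIncGamma (k : ℝ) (w : ℂ) : ℂ :=
  w ^ ((1 - k : ℝ) : ℂ) * Complex.exp (-w) * gammaKernel k w

lemma cIncGamma_ofReal (k : ℝ) {x : ℝ} (hx : 0 < x) :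
    cIncGamma k x = (incGamma (1 - k) x : ℂ) := by
  rw [cIncGamma, gammaKernel_ofReal, incGamma_eq_integral k hx, ← Complex.ofReal_cpow hx.le]
  push_cast
  rfl

lemma differentiableAt_cIncGamma (k : ℝ) {w : ℂ} (hw : 0 < w.re) :
    DifferentiableAt ℂ (cIncGamma k) w := by
  have h0 : w ∈ Complex.slitPlane := Or.inl hw
  exact (((differentiableAt_id.cpow_const h0)).mul (by fun_prop)).mul
    (differentiableAt_gammaKernel k hw)

lemma deriv_cIncGamma_ofReal (k : ℝ) {x : ℝ} (hx : 0 < x) :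
    deriv (cIncGamma k) x = -((Real.exp (-x) * x ^ (-k) : ℝ) : ℂ) := by
  have h1 := (differentiableAt_cIncGamma k (w := x) (by simpa using hx)).hasDerivAt.comp_ofReal
  have h2 : HasDerivAt (fun y : ℝ => cIncGamma k y)
      ((-(Real.exp (-x) * x ^ (1 - k - 1)) : ℝ) : ℂ) x := by
    refine (hasDerivAt_incGamma (1 - k) hx).ofReal_comp.congr_of_eventuallyEq ?_
    filter_upwards [Ioi_mem_nhds hx] with y hy
    exact cIncGamma_ofReal k hy
  rw [h1.unique h2, show 1 - k - 1 = -k by ring, Complex.ofReal_neg]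

/-- The exponent $1-k$ is real, so $|w^{1-k}|=|w|^{1-k}$ without a factor from the argument, and the
arbitrarily small $\delta$ absorbs this power. The kernel integral is at most its value at
$\varepsilon$. -/
lemma norm_cIncGamma_le (k : ℝ) {ε δ : ℝ} (hε : 0 < ε) (hδ : 0 < δ) :
    ∃ C : ℝ, 0 ≤ C ∧ ∀ w : ℂ, ε ≤ w.re →
      ‖cIncGamma k w‖ ≤ C * Real.exp (δ * ‖w‖ - w.re) := by
  obtain ⟨C, hC, h⟩ := rpow_le_const_mul_exp (1 - k) hδ hε
  refine ⟨C * ∫ t in Ioi (0 : ℝ), Real.exp (-ε * t) * (1 + t) ^ (-k),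
    mul_nonneg hC.le (setIntegral_nonneg measurableSet_Ioi fun t (ht : 0 < t) => by positivity),
    fun w hw => ?_⟩
  have hw0 : w ≠ 0 := fun h => by simp [h] at hw; linarith
  have h1 : ‖w ^ ((1 - k : ℝ) : ℂ)‖ ≤ C * Real.exp (δ * ‖w‖) := by
    rw [Complex.norm_cpow_of_ne_zero hw0]
    simpa using h _ (hw.trans (Complex.re_le_norm w))
  have h2 := norm_gammaKernel_le k hε hw
  rw [cIncGamma, norm_mul, norm_mul, Complex.norm_exp, Complex.neg_re]
  calc _ ≤ C * Real.exp (δ * ‖w‖) * Real.exp (-w.re) *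
        ∫ t in Ioi (0 : ℝ), Real.exp (-ε * t) * (1 + t) ^ (-k) := by gcongr
    _ = _ := by rw [sub_eq_add_neg, Real.exp_add]; ring

/-! ### Series of products of holomorphic functions of two variables -/

section Pairing

variable {ι : Type*}

-- Pass through $\ell^2$: $A(a)=\sum\alpha_i(a)L_i$ takes values in the dual and
-- $B(b)=\sum\beta_i(b)e_i$ in $\ell^2$, both holomorphic in one variable by the Weierstrass test,
-- and $G(a,b)=A(a)(B(b))$. Joint analyticity and the partial derivatives then come from the
-- evaluation pairing, which is bounded and bilinear.
open Classical in
lemma analyticAt_tsum_mul {U W : Set ℂ} (hU : IsOpen U) (hW : IsOpen W) {α β : ι → ℂ → ℂ}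
    {r s : ι → ℝ} (hr : Summable r) (hs : Summable s)
    (hα : ∀ i, DifferentiableOn ℂ (α i) U) (hβ : ∀ i, DifferentiableOn ℂ (β i) W)
    (hαr : ∀ i, ∀ a ∈ U, ‖α i a‖ ≤ r i) (hβs : ∀ i, ∀ b ∈ W, ‖β i b‖ ≤ s i)
    {a₀ b₀ : ℂ} (ha₀ : a₀ ∈ U) (hb₀ : b₀ ∈ W) :
    ∃ G : ℂ × ℂ → ℂ, AnalyticAt ℂ G (a₀, b₀) ∧
      (∀ a ∈ U, ∀ b ∈ W, HasSum (fun i => α i a * β i b) (G (a, b))) ∧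
      HasSum (fun i => deriv (α i) a₀ * β i b₀) (fderiv ℂ G (a₀, b₀) (1, 0)) ∧
      HasSum (fun i => α i a₀ * deriv (β i) b₀) (fderiv ℂ G (a₀, b₀) (0, 1)) := by
  let E := lp (fun _ : ι => ℂ) 2
  let e : ι → E := fun i => lp.single 2 i 1
  let L : ι → E →L[ℂ] ℂ := fun i => lp.evalCLM ℂ (fun _ => ℂ) 2 i
  have hLa : ∀ i (y : E), L i y = y i := fun _ _ => rfl
  have hLe : ∀ i j, L i (e j) = if i = j then 1 else 0 := fun i j => by
    rw [hLa, lp.single_apply, Pi.single_apply]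
  have hL : ∀ i, ‖L i‖ ≤ 1 := fun i =>
    ContinuousLinearMap.opNorm_le_bound _ zero_le_one fun y => by
      rw [hLa, one_mul]
      exact lp.norm_apply_le_norm (by norm_num) y i
  have he : ∀ i, ‖e i‖ ≤ 1 := fun i => by
    rw [lp.norm_single (by norm_num), norm_one]
  have hαL : ∀ i, DifferentiableOn ℂ (fun a => α i a • L i) U := fun i => (hα i).smul_const _
  have hβe : ∀ i, DifferentiableOn ℂ (fun b => β i b • e i) W := fun i => (hβ i).smul_const _
  have hαL' : ∀ i, ∀ a ∈ U, ‖α i a • L i‖ ≤ r i := fun i a ha => by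
    rw [norm_smul]
    exact (mul_le_of_le_one_right (norm_nonneg _) (hL i)).trans (hαr i a ha)
  have hβe' : ∀ i, ∀ b ∈ W, ‖β i b • e i‖ ≤ s i := fun i b hb => by
    rw [norm_smul]
    exact (mul_le_of_le_one_right (norm_nonneg _) (he i)).trans (hβs i b hb)
  let A : ℂ → E →L[ℂ] ℂ := fun a => ∑' i, α i a • L i
  let B : ℂ → E := fun b => ∑' i, β i b • e i
  have hA : DifferentiableOn ℂ A U := Complex.differentiableOn_tsum_of_summable_norm hr hαL hU hαL'
  have hB : DifferentiableOn ℂ B W := Complex.differentiableOn_tsum_of_summable_norm hs hβe hW hβe'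
  have hA1 : ∀ a ∈ U, HasSum (fun i => α i a • L i) (A a) := fun a ha =>
    (Summable.of_norm_bounded hr fun i => hαL' i a ha).hasSum
  have hB1 : ∀ b ∈ W, HasSum (fun i => β i b • e i) (B b) := fun b hb =>
    (Summable.of_norm_bounded hs fun i => hβe' i b hb).hasSum
  have hA2 : HasSum (fun i => deriv (α i) a₀ • L i) (deriv A a₀) := by
    convert! Complex.hasSum_deriv_of_summable_norm hr hαL hU hαL' ha₀ using 2 with i
    exact (((hα i).differentiableAt (hU.mem_nhds ha₀)).hasDerivAt.smul_const (L i)).deriv.symm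
  have hB2 : HasSum (fun i => deriv (β i) b₀ • e i) (deriv B b₀) := by
    convert! Complex.hasSum_deriv_of_summable_norm hs hβe hW hβe' hb₀ using 2 with i
    exact (((hβ i).differentiableAt (hW.mem_nhds hb₀)).hasDerivAt.smul_const (e i)).deriv.symm
  have coord : ∀ {c : ι → ℂ} {y : E}, HasSum (fun i => c i • e i) y → ∀ i, L i y = c i := by
    intro c y hy i
    refine ((L i).hasSum hy).unique ?_
    convert! hasSum_ite_eq i (c i) using 2 with j
    rw [map_smul, hLe, smul_eq_mul, mul_ite, mul_one, mul_zero]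
    by_cases h : i = j
    · simp [h]
    · rw [if_neg h, if_neg (Ne.symm h)]
  -- Evaluation at $y$ is continuous on the dual, so the series for $T$ may be evaluated termwise,
  -- and $L_i y=d_i$.
  have pair : ∀ {c d : ι → ℂ} {T : E →L[ℂ] ℂ} {y : E}, HasSum (fun i => c i • L i) T →
      HasSum (fun i => d i • e i) y → HasSum (fun i => c i * d i) (T y) := by
    intro c d T y hT hy
    convert! (ContinuousLinearMap.apply ℂ ℂ y).hasSum hT using 2 with i
    simp [coord hy i]
  refine ⟨fun p => A p.1 (B p.2), ?_, fun a ha b hb => pair (hA1 a ha) (hB1 b hb), ?_, ?_⟩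
  · have h1 : AnalyticAt ℂ (fun p : ℂ × ℂ => A p.1) (a₀, b₀) :=
      AnalyticAt.fun_comp (g := A) (hA.analyticAt (hU.mem_nhds ha₀)) analyticAt_fst
    have h2 : AnalyticAt ℂ (fun p : ℂ × ℂ => B p.2) (a₀, b₀) :=
      AnalyticAt.fun_comp (g := B) (hB.analyticAt (hW.mem_nhds hb₀)) analyticAt_snd
    exact AnalyticAt.fun_comp (f := fun p : ℂ × ℂ => (A p.1, B p.2))
      ((ContinuousLinearMap.id ℂ (E →L[ℂ] ℂ)).analyticAt_bilinear (A a₀, B b₀)) (h1.prod h2)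
  all_goals
    have h1 : HasFDerivAt (fun p : ℂ × ℂ => A p.1) _ (a₀, b₀) :=
      HasFDerivAt.comp (g := A) (a₀, b₀)
        (hA.differentiableAt (hU.mem_nhds ha₀)).hasDerivAt.hasFDerivAt hasFDerivAt_fst
    have h2 : HasFDerivAt (fun p : ℂ × ℂ => B p.2) _ (a₀, b₀) :=
      HasFDerivAt.comp (g := B) (a₀, b₀)
        (hB.differentiableAt (hW.mem_nhds hb₀)).hasDerivAt.hasFDerivAt hasFDerivAt_snd
    rw [(h1.clm_apply h2).fderiv]
  · simpa using pair hA2 (hB1 b₀ hb₀)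
  · simpa using pair (hA1 a₀ ha₀) hB2

end Pairing

/-! ### Exponential series with coefficients of subexponential growth -/

section Series

variable {ι : Type*} {x : ι → ℝ} {c : ι → ℂ}

/-- The frequencies `x i` tend to infinity so fast that `∑ e^{-ε x i}` converges. -/
def FreqSummable (x : ι → ℝ) : Prop := ∀ ε : ℝ, 0 < ε → Summable fun i => Real.exp (-ε * x i)

/-- The coefficients `c i` grow subexponentially in `x i`. -/
def Subexp (x : ι → ℝ) (c : ι → ℂ) : Prop :=
  ∀ ε : ℝ, 0 < ε → ∃ K : ℝ, 0 ≤ K ∧ ∀ i, ‖c i‖ ≤ K * Real.exp (ε * x i)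

lemma FreqSummable.const_mul {s : ℝ} (hs : 0 < s) (hx : FreqSummable x) :
    FreqSummable fun i => s * x i := fun ε hε => by
  convert! hx (ε * s) (by positivity) using 3
  ring

lemma Subexp.comp_const_mul {s : ℝ} (hs : 0 < s) (hc : Subexp x c) :
    Subexp (fun i => s * x i) c := fun ε hε => by
  obtain ⟨K, hK, h⟩ := hc (ε * s) (by positivity)
  refine ⟨K, hK, fun i => ?_⟩
  rw [← mul_assoc]
  exact h i

lemma Subexp.const_mul (a : ℂ) (hc : Subexp x c) : Subexp x fun i => a * c i := fun ε hε => by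
  obtain ⟨K, hK, h⟩ := hc ε hε
  refine ⟨‖a‖ * K, by positivity, fun i => ?_⟩
  rw [norm_mul, mul_assoc]
  gcongr
  exact h i

lemma Subexp.mul (hc : Subexp x c) {d : ι → ℂ} (hd : Subexp x d) :
    Subexp x fun i => c i * d i := fun ε hε => by
  obtain ⟨K, hK, h⟩ := hc (ε / 2) (by positivity)
  obtain ⟨M, hM, h'⟩ := hd (ε / 2) (by positivity)
  refine ⟨K * M, by positivity, fun i => ?_⟩
  rw [norm_mul, show ε * x i = ε / 2 * x i + ε / 2 * x i by ring, Real.exp_add, mul_mul_mul_comm]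
  exact mul_le_mul (h i) (h' i) (norm_nonneg _) (by positivity)

lemma subexp_ofReal {x₀ : ℝ} (hx₀ : ∀ i, x₀ ≤ x i) : Subexp x fun i => (x i : ℂ) := fun ε hε => by
  refine ⟨ε⁻¹ + |x₀| * Real.exp (ε * |x₀|), by positivity, fun i => ?_⟩
  rw [Complex.norm_real, Real.norm_eq_abs, add_mul]
  rcases le_or_gt 0 (x i) with h | h
  · rw [abs_of_nonneg h]
    have := Real.add_one_le_exp (ε * x i)
    have h2 : x i ≤ ε⁻¹ * Real.exp (ε * x i) := by
      rw [inv_mul_eq_div, le_div_iff₀ hε]; linarith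
    have : 0 ≤ |x₀| * Real.exp (ε * |x₀|) * Real.exp (ε * x i) := by positivity
    linarith
  · have h1 : |x i| ≤ |x₀| := by
      rw [abs_of_neg h]; have := hx₀ i; have := neg_abs_le x₀; linarith
    have h3 : 1 ≤ Real.exp (ε * |x₀|) * Real.exp (ε * x i) := by
      rw [← Real.exp_add, ← mul_add, Real.one_le_exp_iff]
      have := neg_abs_le (x i)
      exact mul_nonneg hε.le (by linarith)
    have : 0 ≤ ε⁻¹ * Real.exp (ε * x i) := by positivity
    rw [mul_assoc]
    nlinarith [abs_nonneg x₀]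

lemma subexp_rpow {x₀ : ℝ} (hx₀ : 0 < x₀) (hx : ∀ i, x₀ ≤ x i) (p : ℝ) :
    Subexp x fun i => ((x i ^ p : ℝ) : ℂ) := fun ε hε => by
  obtain ⟨C, hC, h⟩ := rpow_le_const_mul_exp p hε hx₀
  refine ⟨C, hC.le, fun i => ?_⟩
  have := hx₀.trans_le (hx i)
  rw [Complex.norm_real, Real.norm_of_nonneg (by positivity)]
  exact h _ (hx i)

/-- `∑ c i e^{i x z}`. -/
def holSeries (x : ι → ℝ) (c : ι → ℂ) (z : ℂ) : ℂ :=
  ∑' i, c i * Complex.exp (Complex.I * x i * z)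

lemma norm_exp_I_mul (t : ℝ) (z : ℂ) :
    ‖Complex.exp (Complex.I * t * z)‖ = Real.exp (-(t * z.im)) := by
  rw [Complex.norm_exp]
  simp

/-- Frequencies may be negative, so $e^{-x_iv}$ may attain its maximum over $[a,b]$ at either end;
the sum of the two endpoint values covers both cases. Subexponential growth at rate $a/2$ leaves the
positive decay rates $a/2$ and $b-a/2$. -/
lemma exists_summable_bound_holSeries (hx : FreqSummable x) (hc : Subexp x c) {a b : ℝ}
    (ha : 0 < a) (hab : a ≤ b) : ∃ u : ι → ℝ, Summable u ∧ ∀ i (v : ℝ), a ≤ v → v ≤ b →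
      ‖c i‖ * Real.exp (-(x i * v)) ≤ u i := by
  obtain ⟨K, hK, h⟩ := hc (a / 2) (half_pos ha)
  refine ⟨fun i => K * (Real.exp (-(a / 2) * x i) + Real.exp (-(b - a / 2) * x i)),
    ((hx _ (half_pos ha)).add (hx _ (by linarith))).mul_left K, fun i v h1 h2 => ?_⟩
  have h3 : Real.exp (-(x i * v)) ≤ Real.exp (-(x i * a)) + Real.exp (-(x i * b)) := by
    rcases le_or_gt 0 (x i) with h0 | h0
    · have : Real.exp (-(x i * v)) ≤ Real.exp (-(x i * a)) := by gcongr
      linarith [Real.exp_pos (-(x i * b))]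
    · have : Real.exp (-(x i * v)) ≤ Real.exp (-(x i * b)) :=
        Real.exp_le_exp.2 (by nlinarith)
      linarith [Real.exp_pos (-(x i * a))]
  calc _ ≤ K * Real.exp (a / 2 * x i) * (Real.exp (-(x i * a)) + Real.exp (-(x i * b))) := by
        gcongr; exact h i
    _ = _ := by
        rw [mul_assoc, mul_add, ← Real.exp_add, ← Real.exp_add]
        ring_nf

lemma norm_holSeries_term (i : ι) (z : ℂ) :
    ‖c i * Complex.exp (Complex.I * x i * z)‖ = ‖c i‖ * Real.exp (-(x i * z.im)) := by
  rw [norm_mul, norm_exp_I_mul]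

lemma summable_holSeries (hx : FreqSummable x) (hc : Subexp x c) {z : ℂ} (hz : 0 < z.im) :
    Summable fun i => c i * Complex.exp (Complex.I * x i * z) := by
  obtain ⟨u, hu, h⟩ := exists_summable_bound_holSeries hx hc hz le_rfl
  exact Summable.of_norm_bounded hu fun i => by
    rw [norm_holSeries_term]; exact h i _ le_rfl le_rfl

lemma hasDerivAt_holSeries (hx : FreqSummable x) (hc : Subexp x c) {z : ℂ} (hz : 0 < z.im) :
    HasDerivAt (holSeries x c) (holSeries x (fun i => Complex.I * x i * c i) z) z := by
  obtain ⟨u, hu, h⟩ := exists_summable_bound_holSeries hx hc (half_pos hz)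
    (show z.im / 2 ≤ 2 * z.im by linarith)
  have hU : IsOpen {w : ℂ | z.im / 2 < w.im ∧ w.im < 2 * z.im} :=
    (isOpen_lt continuous_const Complex.continuous_im).inter
      (isOpen_lt Complex.continuous_im continuous_const)
  have hzU : z ∈ {w : ℂ | z.im / 2 < w.im ∧ w.im < 2 * z.im} :=
    ⟨by linarith, by linarith⟩
  have hd : ∀ i, DifferentiableOn ℂ (fun w => c i * Complex.exp (Complex.I * x i * w))
    {w : ℂ | z.im / 2 < w.im ∧ w.im < 2 * z.im} := fun i => by fun_prop
  have hb : ∀ i, ∀ w ∈ {w : ℂ | z.im / 2 < w.im ∧ w.im < 2 * z.im},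
      ‖c i * Complex.exp (Complex.I * x i * w)‖ ≤ u i := fun i w hw => by
    rw [norm_holSeries_term]; exact h i _ hw.1.le hw.2.le
  have h1 := (Complex.differentiableOn_tsum_of_summable_norm hu hd hU hb).differentiableAt
    (hU.mem_nhds hzU)
  have h2 := Complex.hasSum_deriv_of_summable_norm hu hd hU hb hzU
  have h3 : deriv (holSeries x c) z = holSeries x (fun i => Complex.I * x i * c i) z := by
    refine h2.tsum_eq.symm.trans (tsum_congr fun i => ?_)
    have : HasDerivAt (fun w : ℂ => c i * Complex.exp (Complex.I * x i * w))
        (c i * (Complex.exp (Complex.I * x i * z) * (Complex.I * x i * 1))) z :=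
      (((hasDerivAt_id z).const_mul _).cexp).const_mul _
    rw [this.deriv]
    ring
  rw [← h3]
  exact h1.hasDerivAt

/-- `∑ c i Γ(1 - k, x i v) e^{-i x z / 2}` with `v = im z`. -/
def nonholSeries (k : ℝ) (x : ι → ℝ) (c : ι → ℂ) (z : ℂ) : ℂ :=
  ∑' i, c i * (incGamma (1 - k) (x i * z.im) : ℂ) * Complex.exp (-(Complex.I * x i / 2) * z)

/-- Treat $\tau$ and $v$ as independent complex variables $a$, $b$: each term is a function of $a$
times $\Gamma(1-k,x_ib)$, both holomorphic. The $b$-derivative contributes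
$-x_i^{1-k}v^{-k}e^{-x_iv}$, and $e^{-ix_iz/2}e^{-x_iv}=e^{i(x_i/2)(-\bar z)}$, so it is $v^{-k}$
times a holomorphic series at $-\bar z$. -/
lemma exists_analytic_nonholSeries (k : ℝ) {x₀ : ℝ} (hx₀ : 0 < x₀) (hxx₀ : ∀ i, x₀ ≤ x i)
    (hx : FreqSummable x) (hc : Subexp x c) {z : ℂ} (hz : 0 < z.im) :
    ∃ G : ℂ × ℂ → ℂ, AnalyticAt ℂ G (z, z.im) ∧
      (∀ᶠ w in 𝓝 z, HasSum (fun i => c i * (incGamma (1 - k) (x i * w.im) : ℂ) *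
        Complex.exp (-(Complex.I * x i / 2) * w)) (G (w, w.im))) ∧
      fderiv ℂ G (z, z.im) (1, 0) = nonholSeries k x (fun i => -(Complex.I * x i / 2) * c i) z ∧
      fderiv ℂ G (z, z.im) (0, 1) = ((z.im ^ (-k) : ℝ) : ℂ) * holSeries (fun i => 1 / 2 * x i)
        (fun i => -((x i ^ (1 - k) : ℝ) : ℂ) * c i) (-(starRingEnd ℂ) z) := by
  set v := z.im with hv
  have hU : IsOpen {a : ℂ | a.im < 11 / 10 * v} :=
    isOpen_lt Complex.continuous_im continuous_const
  have hW : IsOpen {b : ℂ | 19 / 20 * v < b.re ∧ ‖b‖ < 21 / 20 * v} :=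
    (isOpen_lt continuous_const Complex.continuous_re).inter
      (isOpen_lt continuous_norm continuous_const)
  have hxpos : ∀ i, 0 < x i := fun i => hx₀.trans_le (hxx₀ i)
  obtain ⟨K, hK, hcK⟩ := hc (1 / 10 * v) (by positivity)
  obtain ⟨C, hC, hcC⟩ := norm_cIncGamma_le k (ε := x₀ * (19 / 20 * v)) (δ := 1 / 21)
    (by positivity) (by norm_num)
  have hzU : z ∈ {a : ℂ | a.im < 11 / 10 * v} := show z.im < 11 / 10 * v by linarith
  have hvW : (v : ℂ) ∈ {b : ℂ | 19 / 20 * v < b.re ∧ ‖b‖ < 21 / 20 * v} := by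
    constructor
    · rw [Complex.ofReal_re]; linarith
    · rw [Complex.norm_real, Real.norm_of_nonneg hz.le]; linarith
  have hα : ∀ i a, HasDerivAt (fun a => c i * Complex.exp (-(Complex.I * x i / 2) * a) *
      Real.exp (-(3 / 4 * x i * v))) (-(Complex.I * x i / 2) * c i *
        Complex.exp (-(Complex.I * x i / 2) * a) * Real.exp (-(3 / 4 * x i * v))) a := fun i a => by
    have : HasDerivAt (fun a : ℂ => c i * Complex.exp (-(Complex.I * x i / 2) * a) *
      Real.exp (-(3 / 4 * x i * v))) (c i * (Complex.exp (-(Complex.I * x i / 2) * a) *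
        (-(Complex.I * x i / 2) * 1)) * Real.exp (-(3 / 4 * x i * v))) a :=
      ((((hasDerivAt_id a).const_mul _).cexp).const_mul _).mul_const _
    convert! this using 1
    ring
  have hβ : ∀ i, ∀ b : ℂ, 0 < b.re →
      HasDerivAt (fun b => cIncGamma k (x i * b) * Real.exp (3 / 4 * x i * v))
        (x i * deriv (cIncGamma k) (x i * b) * Real.exp (3 / 4 * x i * v)) b := fun i b hb => by
    have h0 : 0 < ((x i : ℂ) * b).re := by
      rw [Complex.re_ofReal_mul]; exact mul_pos (hxpos i) hb
    have h1 : HasDerivAt (fun b : ℂ => (x i : ℂ) * b) (x i) b := by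
      simpa using (hasDerivAt_id b).const_mul (x i : ℂ)
    have := ((differentiableAt_cIncGamma k h0).hasDerivAt.comp b h1).mul_const
      ((Real.exp (3 / 4 * x i * v) : ℝ) : ℂ)
    convert! this using 1
    ring
  have hWre : ∀ b ∈ {b : ℂ | 19 / 20 * v < b.re ∧ ‖b‖ < 21 / 20 * v}, 0 < b.re :=
    fun b hb => lt_trans (by positivity) hb.1
  -- Near $(z,v)$ the exponential grows like $e^{x_iv/2}$ and the gamma factor decays like
  -- $e^{-x_iv}$. The weights $e^{\mp 3x_iv/4}$ cancel in the product and make each factor summable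
  -- on its own: the exponents are $\frac1{10}+\frac{11}{20}-\frac34=-\frac1{10}$ and
  -- $\frac1{20}-\frac{19}{20}+\frac34=-\frac3{20}$, times $x_iv$.
  obtain ⟨G, hG, hGs, hG1, hG2⟩ := analyticAt_tsum_mul hU hW
    (α := fun i a => c i * Complex.exp (-(Complex.I * x i / 2) * a) *
      Real.exp (-(3 / 4 * x i * v)))
    (β := fun i b => cIncGamma k (x i * b) * Real.exp (3 / 4 * x i * v))
    (r := fun i => K * Real.exp (-(1 / 10 * v) * x i))
    (s := fun i => C * Real.exp (-(3 / 20 * v) * x i))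
    ((hx _ (by positivity)).mul_left K) ((hx _ (by positivity)).mul_left C)
    (fun i a _ => (hα i a).differentiableAt.differentiableWithinAt)
    (fun i b hb => (hβ i b (hWre b hb)).differentiableAt.differentiableWithinAt)
    (fun i a ha => by
      have e1 : (-(Complex.I * x i / 2) * a) = Complex.I * ((-(x i / 2) : ℝ) : ℂ) * a := by
        push_cast; ring
      rw [norm_mul, norm_mul, e1, norm_exp_I_mul, Complex.norm_real,
        Real.norm_of_nonneg (Real.exp_nonneg _)]
      calc _ ≤ K * Real.exp (1 / 10 * v * x i) * Real.exp (11 / 20 * v * x i) *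
            Real.exp (-(3 / 4 * x i * v)) := by
            gcongr
            · exact hcK i
            · have : a.im < 11 / 10 * v := ha
              have := mul_le_mul_of_nonneg_left this.le (hxpos i).le
              linarith
        _ = _ := by
            rw [mul_assoc, mul_assoc, ← Real.exp_add, ← Real.exp_add]; ring_nf)
    (fun i b hb => by
      have hre : ((x i : ℂ) * b).re = x i * b.re := Complex.re_ofReal_mul _ _
      have hb1 : 19 / 20 * v < b.re := hb.1
      have hb2 : ‖b‖ < 21 / 20 * v := hb.2
      have h1 := hcC (x i * b) (by
        rw [hre]
        exact mul_le_mul (hxx₀ i) hb1.le (by positivity) (hxpos i).le)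
      rw [norm_mul, Complex.norm_real, Real.norm_of_nonneg (Real.exp_nonneg _)]
      calc _ ≤ C * Real.exp (1 / 21 * ‖(x i : ℂ) * b‖ - ((x i : ℂ) * b).re) *
            Real.exp (3 / 4 * x i * v) := by gcongr
        _ ≤ C * Real.exp (1 / 21 * (x i * (21 / 20 * v)) - x i * (19 / 20 * v)) *
            Real.exp (3 / 4 * x i * v) := by
            have := (hxpos i).le
            rw [hre, norm_mul, Complex.norm_real, Real.norm_of_nonneg this]
            gcongr
        _ = _ := by rw [mul_assoc, ← Real.exp_add]; ring_nf)
    hzU hvW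
  have hexp : ∀ i, ((Real.exp (-(3 / 4 * x i * v)) : ℝ) : ℂ) * Real.exp (3 / 4 * x i * v) = 1 := by
    intro i
    rw [← Complex.ofReal_mul, ← Real.exp_add, neg_add_cancel, Real.exp_zero, Complex.ofReal_one]
  have hval : ∀ i (y : ℝ), 0 < y → cIncGamma k (x i * y) = (incGamma (1 - k) (x i * y) : ℂ) := by
    intro i y hy
    rw [← Complex.ofReal_mul, cIncGamma_ofReal k (mul_pos (hxpos i) hy)]
  refine ⟨G, hG, ?_, ?_, ?_⟩
  · have hc1 : ContinuousAt (fun w : ℂ => (w.im : ℂ)) z := by fun_prop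
    filter_upwards [hU.mem_nhds hzU, hc1.preimage_mem_nhds (hW.mem_nhds hvW)] with w hw1 hw2
    convert! hGs w hw1 _ hw2 using 2 with i
    rw [hval i _ (by simpa using hWre _ hw2)]
    linear_combination (-(c i * (incGamma (1 - k) (x i * w.im) : ℂ) *
      Complex.exp (-(Complex.I * x i / 2) * w))) * hexp i
  · refine hG1.tsum_eq.symm.trans (tsum_congr fun i => ?_)
    rw [(hα i z).deriv, hval i v hz]
    linear_combination (-(Complex.I * x i / 2) * c i * (incGamma (1 - k) (x i * v) : ℂ) *
      Complex.exp (-(Complex.I * x i / 2) * z)) * hexp i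
  · rw [holSeries, ← tsum_mul_left]
    refine hG2.tsum_eq.symm.trans (tsum_congr fun i => ?_)
    rw [(hβ i v (by simpa using hz)).deriv, ← Complex.ofReal_mul,
      deriv_cIncGamma_ofReal k (mul_pos (hxpos i) hz), Real.mul_rpow (hxpos i).le hz.le,
      sub_eq_add_neg 1 k, Real.rpow_add (hxpos i), Real.rpow_one]
    have e1 : Complex.exp (Complex.I * ((1 / 2 * x i : ℝ) : ℂ) * (-(starRingEnd ℂ) z)) =
        Complex.exp (-(Complex.I * x i / 2) * z) * Real.exp (-(x i * v)) := by
      rw [Complex.ofReal_exp, ← Complex.exp_add]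
      congr 1
      push_cast
      have h1 := Complex.sub_conj z
      push_cast at h1
      linear_combination (Complex.I * x i / 2) * h1 + (x i : ℂ) * v * Complex.I_sq
    rw [e1]
    push_cast
    push_cast at hexp
    linear_combination (-(c i * x i * Complex.exp (-(x i * v)) * ((x i ^ (-k) : ℝ) : ℂ) *
      ((v ^ (-k) : ℝ) : ℂ) * Complex.exp (-(Complex.I * x i / 2) * z))) * hexp i

end Series

/-! ### Functions whose `τ̄`-derivative is `v^{-k}` times an antiholomorphic function -/

section Uniqueness

variable {V : Type*} [NormedAddCommGroup V] [NormedSpace ℂ V]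

/-- The `τ̄`-part `(L(1) + i L(i)) / 2` of a real-linear map. -/
def barPart (L : ℂ →L[ℝ] V) : V := (1 / 2 : ℂ) • (L 1 + Complex.I • L Complex.I)

lemma map_eq_re_im (L : ℂ →L[ℝ] V) (a : ℂ) : L a = (a.re : ℂ) • L 1 + (a.im : ℂ) • L Complex.I := by
  conv_lhs => rw [show a = a.re • (1 : ℂ) + a.im • Complex.I by
    rw [Complex.real_smul, Complex.real_smul, mul_one, Complex.re_add_im]]
  rw [map_add, map_smul, map_smul, Complex.coe_smul, Complex.coe_smul]

/-- Write $Lw=Aw+B\bar w$; then `barPart` is $B$, and precomposition with multiplication by $a$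
turns $B$ into $\bar aB$. This is the chain rule for $\partial/\partial\bar z$ along a holomorphic
map. -/
lemma half_smul_map_mul (L : ℂ →L[ℝ] V) (a : ℂ) :
    (1 / 2 : ℂ) • (L (1 * a) + Complex.I • L (Complex.I * a)) = (starRingEnd ℂ) a • barPart L := by
  rw [map_eq_re_im L (1 * a), map_eq_re_im L (Complex.I * a), barPart]
  have h : (starRingEnd ℂ) a = (a.re : ℂ) - (a.im : ℂ) * Complex.I := by
    apply Complex.ext <;> simp
  rw [h]
  simp only [one_mul, Complex.I_mul_re, Complex.I_mul_im, Complex.ofReal_neg]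
  match_scalars
  · ring
  · linear_combination (1 / 2 : ℂ) * (a.im : ℂ) * Complex.I_sq

lemma eq_zero_of_eq_zero_on_imaginary_axis [CompleteSpace V] {g : ℂ → V}
    (hg : ∀ z : ℂ, 0 < z.im → DifferentiableAt ℂ g z)
    (h0 : ∀ y : ℝ, 0 < y → g (y * Complex.I) = 0) {z : ℂ} (hz : 0 < z.im) : g z = 0 := by
  have hopen : IsOpen {z : ℂ | 0 < z.im} := isOpen_lt continuous_const Complex.continuous_im
  have han : AnalyticOnNhd ℂ g {z : ℂ | 0 < z.im} :=
    DifferentiableOn.analyticOnNhd (fun w hw => (hg w hw).differentiableWithinAt) hopen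
  have hconn : IsPreconnected {z : ℂ | 0 < z.im} :=
    (convex_halfSpace_im_gt 0).isPreconnected
  refine han.eqOn_zero_of_preconnected_of_frequently_eq_zero hconn (z₀ := Complex.I)
    (by simp) ?_ hz
  have ht : Tendsto (fun y : ℝ => (y : ℂ) * Complex.I) (𝓝[≠] 1) (𝓝[≠] Complex.I) := by
    refine tendsto_nhdsWithin_iff.2 ⟨?_, ?_⟩
    · have : ContinuousAt (fun y : ℝ => (y : ℂ) * Complex.I) 1 := by fun_prop
      simpa using this.tendsto.mono_left nhdsWithin_le_nhds
    · filter_upwards [self_mem_nhdsWithin] with y hy h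
      have h' : (y : ℂ) * Complex.I = Complex.I := h
      have := congrArg Complex.im h'
      simp only [Complex.mul_im, Complex.ofReal_re, Complex.I_im, mul_one, Complex.ofReal_im,
        Complex.I_re, mul_zero, add_zero] at this
      exact hy this
  refine ht.frequently (Eventually.frequently ?_)
  exact (eventually_nhdsWithin_of_eventually_nhds (Ioi_mem_nhds one_pos)).mono fun y hy => h0 y hy

lemma im_neg_inv (z : ℂ) : (-z⁻¹).im = z.im / Complex.normSq z := by
  rw [Complex.neg_im, Complex.inv_im, neg_div, neg_neg]

lemma im_neg_inv_pos {z : ℂ} (hz : 0 < z.im) : 0 < (-z⁻¹).im := by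
  rw [im_neg_inv]
  exact div_pos hz (Complex.normSq_pos.2 fun h => by simp [h] at hz)

lemma arg_ne_pi_of_im_pos {z : ℂ} (hz : 0 < z.im) : z.arg ≠ Real.pi := fun h => by
  have := (Complex.arg_eq_pi_iff.1 h).2
  exact hz.ne' this

/-- Conjugation commutes with principal powers off the negative axis. The lemma splits the factor
$|z|^{2k}$ arising from $\mathrm{Im}(-1/z)^{-k}$ into a holomorphic and an antiholomorphic part. -/
lemma normSq_rpow_eq_cpow_mul {z : ℂ} (hz : 0 < z.im) (k : ℝ) :
    ((Complex.normSq z ^ k : ℝ) : ℂ) = z ^ (k : ℂ) * ((starRingEnd ℂ) z) ^ (k : ℂ) := by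
  have h1 := Complex.cpow_conj ((starRingEnd ℂ) z) k (by
    rw [Complex.arg_conj, if_neg (arg_ne_pi_of_im_pos hz)]
    intro h
    have := Complex.neg_pi_lt_arg z
    linarith)
  have hz0 : z ≠ 0 := fun h => by simp [h] at hz
  rw [Complex.conj_conj, Complex.conj_ofReal] at h1
  rw [h1, Complex.mul_conj, Complex.normSq_eq_norm_sq, Complex.normSq_eq_norm_sq,
    Complex.norm_cpow_of_ne_zero hz0, Complex.ofReal_re, Complex.ofReal_im, mul_zero, Real.exp_zero,
    div_one, ← Real.rpow_natCast, ← Real.rpow_natCast, ← Real.rpow_mul (norm_nonneg _),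
    ← Real.rpow_mul (norm_nonneg _), mul_comm]

/-- The defect of the inversion law has two holomorphic obstructions: first the function $P$
governing its $\bar z$-derivative, then, once $P=0$, the defect itself. The hypotheses `h0` and `h1`
are the law and its horizontal derivative on the axis; together they make both obstructions vanish
there, and the identity theorem applies twice. -/
theorem inversion_formula_of_imaginary_axis [CompleteSpace V] (k : ℝ) (M : V →L[ℂ] V) {F H : ℂ → V}
    (hF : ∀ z : ℂ, 0 < z.im → DifferentiableAt ℝ F z)
    (hH : ∀ z : ℂ, 0 < z.im → DifferentiableAt ℂ H z)
    (hbar : ∀ z : ℂ, 0 < z.im → barPart (fderiv ℝ F z) =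
      ((z.im ^ (-k) : ℝ) : ℂ) • H (-(starRingEnd ℂ) z))
    (h0 : ∀ y : ℝ, 0 < y → F (-(y * Complex.I)⁻¹) =
      (y * Complex.I) ^ (k : ℂ) • M (F (y * Complex.I)))
    (h1 : ∀ y : ℝ, 0 < y → -((y : ℂ) ^ 2)⁻¹ • fderiv ℝ F (-(y * Complex.I)⁻¹) 1 =
      ((k : ℂ) * (y * Complex.I) ^ ((k : ℂ) - 1)) • M (F (y * Complex.I)) +
        (y * Complex.I) ^ (k : ℂ) • M (fderiv ℝ F (y * Complex.I) 1))
    {z : ℂ} (hz : 0 < z.im) : F (-z⁻¹) = z ^ (k : ℂ) • M (F z) := by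
  set Φ : ℂ → V := fun z => F (-z⁻¹) - z ^ (k : ℂ) • M (F z) with hΦ
  have hyI : ∀ y : ℝ, 0 < y → 0 < ((y : ℂ) * Complex.I).im := fun y hy => by simpa using hy
  have hne : ∀ {z : ℂ}, 0 < z.im → z ≠ 0 := fun {z} hz h => by simp [h] at hz
  have hΦ' : ∀ z : ℂ, 0 < z.im → ∃ L : ℂ →L[ℝ] V, HasFDerivAt Φ L z ∧
      ∀ w, L w = fderiv ℝ F (-z⁻¹) (w * (z ^ 2)⁻¹) -
        ((k * z ^ ((k : ℂ) - 1) * w) • M (F z) + z ^ (k : ℂ) • M (fderiv ℝ F z w)) := by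
    intro z hz
    have hz0 := hne hz
    have e1 : HasDerivAt (fun z : ℂ => -z⁻¹) ((z ^ 2)⁻¹) z := by
      convert! (hasDerivAt_inv hz0).neg using 1
      rw [neg_neg]
    have e2 : HasDerivAt (fun z : ℂ => z ^ (k : ℂ)) (k * z ^ ((k : ℂ) - 1)) z := by
      simpa using (hasDerivAt_id z).cpow_const (c := (k : ℂ)) (Or.inr hz.ne')
    have e3 := (hF _ (im_neg_inv_pos hz)).hasFDerivAt.comp z
      (e1.hasFDerivAt.restrictScalars ℝ)
    have e4 := (e2.hasFDerivAt.restrictScalars ℝ).smul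
      (((M.restrictScalars ℝ).hasFDerivAt).comp z (hF z hz).hasFDerivAt)
    refine ⟨_, e3.sub e4, fun w => ?_⟩
    simp [mul_comm w, add_comm]
  have hΦ0 : ∀ y : ℝ, 0 < y → Φ (y * Complex.I) = 0 := fun y hy => sub_eq_zero.2 (h0 y hy)
  -- At $w=-\bar z$ the factor $(-w)^k$ is $\bar z^k$, the antiholomorphic half of $|z|^{2k}$, and
  -- $(w^2)^{-1}$ is the conjugate of the derivative $z^{-2}$ of $-1/z$.
  let P : ℂ → V := fun w => ((-w) ^ (k : ℂ) * (w ^ 2)⁻¹) • H (-w⁻¹) - M (H w)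
  have hPbar : ∀ z : ℂ, 0 < z.im → ∀ L : ℂ →L[ℝ] V, HasFDerivAt Φ L z →
      barPart L = (((z.im ^ (-k) : ℝ) : ℂ) * z ^ (k : ℂ)) • P (-(starRingEnd ℂ) z) := by
    intro z hz L hL
    obtain ⟨L', hL', hL'w⟩ := hΦ' z hz
    have hz0 := hne hz
    obtain rfl := hL.unique hL'
    have e1 : barPart L = (starRingEnd ℂ) (z ^ 2)⁻¹ • barPart (fderiv ℝ F (-z⁻¹)) -
        z ^ (k : ℂ) • M (barPart (fderiv ℝ F z)) := by
      rw [← half_smul_map_mul, barPart, hL'w, hL'w]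
      simp only [barPart, map_smul, map_add]
      generalize z ^ ((k : ℂ) - 1) = q
      match_scalars <;> (try ring1)
      linear_combination -(1 / 2 : ℂ) * (k * q) * Complex.I_sq
    rw [e1, hbar _ (im_neg_inv_pos hz), hbar z hz, im_neg_inv, Real.div_rpow hz.le
      (Complex.normSq_nonneg _), Real.rpow_neg (Complex.normSq_nonneg z), div_inv_eq_mul,
      Complex.ofReal_mul, normSq_rpow_eq_cpow_mul hz]
    simp only [P, map_neg, map_inv₀, map_pow, neg_neg, inv_neg, neg_sq, map_smul]
    module
  have hP0 : ∀ w : ℂ, 0 < w.im → P w = 0 := by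
    intro w hw
    refine eq_zero_of_eq_zero_on_imaginary_axis (fun w hw => ?_) (fun y hy => ?_) hw
    · have d1 : DifferentiableAt ℂ (fun w : ℂ => (-w) ^ (k : ℂ)) w :=
        differentiableAt_id.neg.cpow_const (Or.inr (by simpa using hw.ne'))
      have d2 : DifferentiableAt ℂ (fun w : ℂ => (w ^ 2)⁻¹) w :=
        (differentiableAt_id.pow 2).inv (pow_ne_zero 2 (hne hw))
      have d3 : DifferentiableAt ℂ (fun w : ℂ => H (-w⁻¹)) w :=
        (hH _ (im_neg_inv_pos hw)).comp w (differentiableAt_id.inv (hne hw)).neg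
      exact ((d1.mul d2).smul d3).sub (M.differentiableAt.comp w (hH w hw))
    · obtain ⟨L, hL, hLw⟩ := hΦ' _ (hyI y hy)
      -- On the axis the derivative $z^{-2}=-y^{-2}$ of $-1/z$ is real, so it comes out of the
      -- real-linear map and `h1` applies.
      have hL1 : L 1 = 0 := by
        rw [hLw, one_mul, mul_one, ← h1 y hy, sub_eq_zero]
        have : (((y : ℂ) * Complex.I) ^ 2)⁻¹ = (-(y ^ 2)⁻¹ : ℝ) • (1 : ℂ) := by
          rw [mul_pow, Complex.I_sq, mul_neg_one, inv_neg, Complex.real_smul]; push_cast; ring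
        rw [this, map_smul, ← Complex.coe_smul]
        push_cast
        rfl
      -- The direction $i$ is tangent to the axis, where $\Phi$ vanishes identically.
      have hLI : L Complex.I = 0 := by
        have d1 : HasDerivAt (fun t : ℝ => (t : ℂ) * Complex.I) Complex.I y := by
          simpa using (Complex.ofRealCLM.hasDerivAt (x := y)).mul_const Complex.I
        have d2 := hL.comp_hasDerivAt y d1
        refine d2.unique ((hasDerivAt_const y (0 : V)).congr_of_eventuallyEq ?_)
        filter_upwards [Ioi_mem_nhds hy] with t ht
        exact hΦ0 t ht
      have := hPbar _ (hyI y hy) L hL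
      rw [barPart, hL1, hLI, smul_zero, add_zero, smul_zero, eq_comm, smul_eq_zero] at this
      -- The map $z\mapsto-\bar z$ fixes the imaginary axis pointwise, so the value of $P$ obtained
      -- is the one at $iy$ itself.
      have hconj : -(starRingEnd ℂ) ((y : ℂ) * Complex.I) = y * Complex.I := by simp
      rw [hconj] at this
      refine this.resolve_left (mul_ne_zero ?_ ?_)
      · have := Real.rpow_pos_of_pos (hyI y hy) (-k)
        exact_mod_cast this.ne'
      · rw [Complex.cpow_def_of_ne_zero (hne (hyI y hy))]
        exact Complex.exp_ne_zero _
  refine sub_eq_zero.1 (eq_zero_of_eq_zero_on_imaginary_axis (g := Φ) (fun z hz => ?_) hΦ0 hz)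
  obtain ⟨L, hL, -⟩ := hΦ' z hz
  refine differentiableAt_complex_iff_differentiableAt_real.2 ⟨hL.differentiableAt, ?_⟩
  have := hPbar z hz L hL
  rw [hP0 _ (by simpa using hz), smul_zero, barPart, smul_eq_zero] at this
  have h2 := this.resolve_left (by norm_num)
  rw [hL.fderiv]
  calc L Complex.I = -Complex.I • (Complex.I • L Complex.I) := by
        rw [smul_smul, neg_mul, Complex.I_mul_I, neg_neg, one_smul]
    _ = _ := by rw [eq_neg_of_add_eq_zero_right h2, smul_neg, neg_smul, neg_neg]

end Uniqueness

/-- $\Delta_k=-4v^{2-k}\frac{\partial}{\partial\tau}\big(v^k\frac{\partial}{\partial\bar\tau}\big)$,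
and here $v^k\,\partial F/\partial\bar\tau=H(-\bar\tau)$ is antiholomorphic. -/
theorem laplacian_eq_zero {m : ℕ} (k : ℝ) {F H : ℂ → Fin m → ℂ}
    (hH : ∀ z : ℂ, 0 < z.im → DifferentiableAt ℂ H z)
    (hbar : ∀ z : ℂ, 0 < z.im → barPart (fderiv ℝ F z) =
      ((z.im ^ (-k) : ℝ) : ℂ) • H (-(starRingEnd ℂ) z))
    {z : ℂ} (hz : 0 < z.im) : laplacian k F z = 0 := by
  have hev : dTauBar F =ᶠ[𝓝 z] fun w => ((w.im ^ (-k) : ℝ) : ℂ) • H (-(starRingEnd ℂ) w) := by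
    filter_upwards [(isOpen_lt continuous_const Complex.continuous_im).mem_nhds hz] with w hw
    exact hbar w hw
  have d1 : HasFDerivAt (fun w : ℂ => ((w.im ^ (-k) : ℝ) : ℂ)) (Complex.ofRealCLM.comp
      ((-k * z.im ^ (-k - 1)) • Complex.imCLM)) z :=
    (Complex.ofRealCLM.hasFDerivAt).comp z
      (((Real.hasDerivAt_rpow_const (Or.inl hz.ne')).comp_hasFDerivAt z
        Complex.imCLM.hasFDerivAt))
  have d2 : HasFDerivAt (fun w : ℂ => -(starRingEnd ℂ) w)
      (-(Complex.conjCLE : ℂ →L[ℝ] ℂ)) z := Complex.conjCLE.hasFDerivAt.neg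
  have hz' : 0 < (-(starRingEnd ℂ) z).im := by simpa using hz
  have d3 := ((hH _ hz').hasDerivAt.hasFDerivAt.restrictScalars ℝ).comp z d2
  have d4 : HasFDerivAt (fun w : ℂ => ((w.im ^ (-k) : ℝ) : ℂ) • H (-(starRingEnd ℂ) w)) _ z :=
    d1.smul d3
  have hv : z.im ^ (-k - 1) * z.im = z.im ^ (-k) := by
    rw [← Real.rpow_add_one hz.ne', sub_add_cancel]
  have hv' : ((z.im ^ (-k - 1) : ℝ) : ℂ) * z.im = ((z.im ^ (-k) : ℝ) : ℂ) := by
    rw [← hv]; push_cast; rfl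
  have key : ∀ w, fderiv ℝ (fun w : ℂ => ((w.im ^ (-k) : ℝ) : ℂ) • H (-(starRingEnd ℂ) w)) z w =
      ((z.im ^ (-k) : ℝ) : ℂ) • (-(starRingEnd ℂ) w) • deriv H (-(starRingEnd ℂ) z) +
        ((-k * z.im ^ (-k - 1) * w.im : ℝ) : ℂ) • H (-(starRingEnd ℂ) z) := fun w => by
    rw [d4.fderiv]; rfl
  rw [laplacian, dTau, hev.fderiv_eq, hev.eq_of_nhds, key, key, ← hv']
  simp only [map_one, Complex.conj_I, Complex.one_im, Complex.I_im, mul_zero, mul_one, neg_neg]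
  push_cast
  match_scalars
  · linear_combination (2 : ℂ) * (z.im : ℂ) ^ 3 * ((z.im ^ (-k - 1) : ℝ) : ℂ) * Complex.I_sq
  · ring

/-! ### Integration against test functions -/

/-- `φ` is integrable on `(0, ∞)` and vanishes there outside a compact interval. -/
def IsCompactIntegrable (φ : ℝ → ℂ) : Prop :=
  IntegrableOn φ (Ioi 0) ∧ ∃ a b : ℝ, 0 < a ∧ a ≤ b ∧ ∀ y, 0 < y → φ y ≠ 0 → y ∈ Icc a b

/-- Exchanging sums and integrals needs only integrability and compact support. This wider class is
stable under `testSlash`, so slashed test functions need not be shown to be piecewise smooth. -/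
lemma IsTestFunction.isCompactIntegrable {φ : ℝ → ℂ} (hφ : IsTestFunction φ) :
    IsCompactIntegrable φ := by
  constructor
  · refine IntegrableOn.of_forall_sdiff_eq_zero (s := tsupport φ) ?_ measurableSet_Ioi
      fun y hy => image_eq_zero_of_notMem_tsupport hy.2
    refine LocallyIntegrableOn.integrableOn_isCompact (fun x hx => ?_) hφ.compactSupport
    obtain ⟨ε, hε, g, h, hg, hh, hgl, hhr, -⟩ := hφ.piecewiseSmooth x (hφ.support_pos hx)
    have i1 : IntegrableOn φ (Ioo (x - ε / 2) x) := by
      refine IntegrableOn.congr_fun (f := g) ?_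
        (fun y hy => (hgl y ⟨by linarith [hy.1], hy.2⟩).symm) measurableSet_Ioo
      exact ((hg.continuousOn.mono fun y hy =>
        ⟨by linarith [hy.1], by linarith [hy.2]⟩).integrableOn_Icc
          (a := x - ε / 2) (b := x)).mono_set Ioo_subset_Icc_self
    have i2 : IntegrableOn φ (Ioo x (x + ε / 2)) := by
      refine IntegrableOn.congr_fun (f := h) ?_
        (fun y hy => (hhr y ⟨hy.1, by linarith [hy.2]⟩).symm) measurableSet_Ioo
      exact ((hh.continuousOn.mono fun y hy =>
        ⟨by linarith [hy.1], by linarith [hy.2]⟩).integrableOn_Icc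
          (a := x) (b := x + ε / 2)).mono_set Ioo_subset_Icc_self
    have i3 : IntegrableOn φ {x} := integrableOn_singleton (hx := by
      rw [Real.volume_singleton]; exact ENNReal.zero_lt_top)
    refine ⟨Ioo (x - ε / 2) (x + ε / 2), mem_nhdsWithin_of_mem_nhds
      (Ioo_mem_nhds (by linarith) (by linarith)), ((i1.union i3).union i2).mono_set ?_⟩
    intro y hy
    rcases lt_trichotomy y x with h | h | h
    · exact Or.inl (Or.inl ⟨hy.1, h⟩)
    · exact Or.inl (Or.inr h)
    · exact Or.inr ⟨h, hy.2⟩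
  · rcases (tsupport φ).eq_empty_or_nonempty with h | h
    · refine ⟨1, 1, one_pos, le_rfl, fun y _ hy => ?_⟩
      have := subset_tsupport φ hy
      rw [h] at this
      exact this.elim
    · have hc : IsCompact (tsupport φ) := hφ.compactSupport
      obtain ⟨a, ha, ha'⟩ := hc.exists_isLeast h
      obtain ⟨b, hb, hb'⟩ := hc.exists_isGreatest h
      exact ⟨a, b, hφ.support_pos ha, ha' hb, fun y _ hy =>
        ⟨ha' (subset_tsupport φ hy), hb' (subset_tsupport φ hy)⟩⟩

lemma IsCompactIntegrable.continuousOn_mul {φ q : ℝ → ℂ} (hφ : IsCompactIntegrable φ)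
    (hq : ContinuousOn q (Ioi 0)) : IsCompactIntegrable fun y => q y * φ y := by
  obtain ⟨hi, a, b, ha, hab, h⟩ := hφ
  have hsub : Icc a b ⊆ Ioi 0 := fun y hy => ha.trans_le hy.1
  refine ⟨IntegrableOn.of_forall_sdiff_eq_zero (s := Icc a b)
    ((hi.mono_set hsub).continuousOn_mul (hq.mono hsub) isCompact_Icc) measurableSet_Ioi
    fun y hy => ?_, a, b, ha, hab, fun y hy hne => h y hy (right_ne_zero_of_mul hne)⟩
  by_contra hne
  exact hy.2 (h y hy.1 (right_ne_zero_of_mul hne))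

lemma continuousOn_ofReal_cpow (s : ℂ) : ContinuousOn (fun y : ℝ => (y : ℂ) ^ s) (Ioi 0) :=
  fun y (hy : 0 < y) => ContinuousAt.continuousWithinAt
    (ContinuousAt.cpow (f := fun y : ℝ => (y : ℂ)) Complex.continuous_ofReal.continuousAt
      continuousAt_const (Complex.ofReal_mem_slitPlane.2 hy))

lemma continuousOn_rpow_ofReal (p : ℝ) : ContinuousOn (fun y : ℝ => ((y ^ p : ℝ) : ℂ)) (Ioi 0) :=
  Complex.continuous_ofReal.comp_continuousOn fun y (hy : 0 < y) =>
    (Real.continuousAt_rpow_const y p (Or.inl hy.ne')).continuousWithinAt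

lemma IsCompactIntegrable.twist {φ : ℝ → ℂ} (hφ : IsCompactIntegrable φ) (s : ℂ) :
    IsCompactIntegrable (twist φ s) := by
  convert! hφ.continuousOn_mul (continuousOn_ofReal_cpow (s - 1)) using 2 with y
  exact mul_comm _ _

lemma IsCompactIntegrable.testSlash {φ : ℝ → ℂ} (hφ : IsCompactIntegrable φ) (k : ℝ)
    (χ : Matrix.SpecialLinearGroup (Fin 2) ℤ → ℂ) :
    IsCompactIntegrable (testSlash k χ φ) := by
  obtain ⟨hi, a, b, ha, hab, h⟩ := hφ
  -- The factor $x^{-2}$ inside $x^{k-2}$ is the Jacobian of $x\mapsto 1/x$; the remaining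
  -- $x^k\chi(S)$ is a continuous multiplier.
  have h1 : IsCompactIntegrable fun x : ℝ => x ^ ((-1 : ℝ) - 1) • φ (x ^ (-1 : ℝ)) := by
    refine ⟨(integrableOn_Ioi_comp_rpow_iff' φ (by norm_num)).2 hi, b⁻¹, a⁻¹,
      inv_pos.2 (ha.trans_le hab), inv_anti₀ ha hab, fun y hy hne => ?_⟩
    have h2 := h _ (Real.rpow_pos_of_pos hy _) (smul_ne_zero_iff.1 hne).2
    rw [Real.rpow_neg_one] at h2
    exact ⟨inv_le_of_inv_le₀ hy h2.2, le_inv_of_le_inv₀ ha h2.1⟩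
  obtain ⟨hi', a', b', ha', hab', h'⟩ := h1.continuousOn_mul
    (q := fun y => ((y ^ k : ℝ) : ℂ) * χ ModularGroup.S)
    ((continuousOn_rpow_ofReal k).mul continuousOn_const)
  have heq : ∀ y : ℝ, 0 < y → ((y ^ k : ℝ) : ℂ) * χ ModularGroup.S *
      (y ^ ((-1 : ℝ) - 1) • φ (y ^ (-1 : ℝ))) = VVMaass.testSlash k χ φ y := fun y hy => by
    rw [VVMaass.testSlash, show k - 2 = k + (-1 - 1) by ring, Real.rpow_add hy, Real.rpow_neg_one,
      one_div, Complex.real_smul]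
    push_cast
    ring
  exact ⟨hi'.congr_fun (fun y hy => heq y hy) measurableSet_Ioi, a', b', ha', hab',
    fun y hy hne => h' y hy ((heq y hy).trans_ne hne)⟩

lemma integral_mul_testSlash (k : ℝ) (χ : Matrix.SpecialLinearGroup (Fin 2) ℤ → ℂ) (φ g : ℝ → ℂ) :
    ∫ y in Ioi (0 : ℝ), g y * testSlash k χ φ y =
      ∫ y in Ioi (0 : ℝ), (χ ModularGroup.S * ((y ^ (-k) : ℝ) : ℂ) * g y⁻¹) * φ y := by
  rw [← integral_comp_rpow_Ioi _ (show (-1 : ℝ) ≠ 0 by norm_num)]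
  refine setIntegral_congr_fun measurableSet_Ioi fun y (hy : 0 < y) => ?_
  rw [testSlash, Real.rpow_neg_one, Complex.real_smul, one_div, inv_inv, abs_neg, abs_one, one_mul,
    Real.inv_rpow hy.le, ← Real.rpow_neg hy.le]
  have : ((y ^ (-1 - 1 : ℝ) : ℝ) : ℂ) * ((y ^ (-(k - 2)) : ℝ) : ℂ) = ((y ^ (-k) : ℝ) : ℂ) := by
    rw [← Complex.ofReal_mul, ← Real.rpow_add hy]; congr 2; ring
  rw [← this]
  ring

lemma hasSum_integral_mul_of_bound {ι : Type*} [Countable ι] {T : ι → ℝ → ℂ} {φ : ℝ → ℂ}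
    (hφ : IsCompactIntegrable φ) (hT : ∀ i, ContinuousOn (T i) (Ioi 0))
    (hb : ∀ a b : ℝ, 0 < a → a ≤ b → ∃ u : ι → ℝ, Summable u ∧
      ∀ i y, a ≤ y → y ≤ b → ‖T i y‖ ≤ u i) :
    HasSum (fun i => ∫ y in Ioi (0 : ℝ), T i y * φ y)
      (∫ y in Ioi (0 : ℝ), (∑' i, T i y) * φ y) := by
  have hφ' := hφ
  obtain ⟨hi, a, b, ha, hab, h⟩ := hφ'
  obtain ⟨u, hu, hTu⟩ := hb a b ha hab
  have hint : ∀ i, IntegrableOn (fun y => T i y * φ y) (Ioi 0) := fun i =>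
    (hφ.continuousOn_mul (hT i)).1
  simp_rw [← tsum_mul_right]
  refine hasSum_integral_of_summable_integral_norm hint ?_
  refine Summable.of_nonneg_of_le (fun i => integral_nonneg fun y => norm_nonneg _) (fun i => ?_)
    (hu.mul_right (∫ y in Ioi (0 : ℝ), ‖φ y‖))
  rw [← integral_const_mul]
  refine setIntegral_mono_on (hint i).norm (hi.norm.const_mul _) measurableSet_Ioi fun y hy => ?_
  rw [norm_mul]
  by_cases h0 : φ y = 0
  · simp [h0]
  · have := h y hy h0
    gcongr
    exact hTu i y this.1 this.2

lemma hasSum_mul_laplace {ι : Type*} [Countable ι] {x : ι → ℝ} {c : ι → ℂ} {φ : ℝ → ℂ}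
    (hφ : IsCompactIntegrable φ) (hx : FreqSummable x) (hc : Subexp x c) :
    HasSum (fun i => c i * laplace φ (x i))
      (∫ y in Ioi (0 : ℝ), holSeries x c (y * Complex.I) * φ y) := by
  convert! hasSum_integral_mul_of_bound (T := fun i (y : ℝ) =>
    c i * Complex.exp (Complex.I * x i * (y * Complex.I))) hφ (fun i => by fun_prop) ?_ using 2
    with i
  · rw [laplace, ← integral_const_mul]
    refine integral_congr_ae (ae_of_all _ fun y => ?_)
    have : Complex.I * x i * (y * Complex.I) = -x i * y := by
      linear_combination (x i * y : ℂ) * Complex.I_sq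
    simp only [this]
    ring
  · intro a b ha hab
    obtain ⟨u, hu, h⟩ := exists_summable_bound_holSeries hx hc ha hab
    refine ⟨u, hu, fun i y h1 h2 => ?_⟩
    rw [norm_holSeries_term]
    simpa using h i y h1 h2

/-- Exchange the integrals: $e^{-(x/2)(2t+1)y}=e^{-xy/2}e^{-xyt}$, so the $t$-integral is
`gammaKernel` at $xy$. The twist supplies $y^{1-k}$, which completes $x^{1-k}$ to the power
$(xy)^{1-k}$ in $\Gamma(1-k,xy)$. -/
lemma integral_laplace_eq (k : ℝ) {x : ℝ} (hx : 0 < x) {φ : ℝ → ℂ} (hφ : IsCompactIntegrable φ) :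
    ((x ^ (1 - k) : ℝ) : ℂ) * ∫ t in Ioi (0 : ℝ),
      laplace (twist φ (2 - k)) ((x / 2 * (2 * t + 1) : ℝ) : ℂ) / (((1 + t) ^ k : ℝ) : ℂ) =
    ∫ y in Ioi (0 : ℝ), (incGamma (1 - k) (x * y) : ℂ) *
      Complex.exp (-(Complex.I * x / 2) * (y * Complex.I)) * φ y := by
  set ψ := twist φ (2 - k) with hψ
  have hψi : IsCompactIntegrable ψ := hφ.twist _
  obtain ⟨hi, a, b, ha, hab, h⟩ := hψi
  let f : ℝ → ℝ → ℂ := fun t y => Complex.exp (-((x / 2 * (2 * t + 1) : ℝ) : ℂ) * y) * ψ y *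
    (((1 + t) ^ (-k) : ℝ) : ℂ)
  have hf : Integrable (Function.uncurry f)
      ((volume.restrict (Ioi (0 : ℝ))).prod (volume.restrict (Ioi (0 : ℝ)))) := by
    -- On the support $y\ge a$, so $e^{-xyt}\le e^{-xat}$, and the integrand is dominated by a
    -- product of functions of $t$ and of $y$.
    have h1 := (integrableOn_exp_mul_one_add_rpow (-k) (mul_pos hx ha)).mul_prod hi.norm
    refine Integrable.mono' h1 ?_ ?_
    · have m1 : AEStronglyMeasurable (fun p : ℝ × ℝ => ψ p.2)
          ((volume.restrict (Ioi (0 : ℝ))).prod (volume.restrict (Ioi (0 : ℝ)))) :=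
        hi.aestronglyMeasurable.comp_snd
      have m2 : AEStronglyMeasurable (fun t : ℝ => (((1 + t) ^ (-k) : ℝ) : ℂ))
          (volume.restrict (Ioi 0)) := by
        simpa using aestronglyMeasurable_gammaKernel_integrand (-k) 0
      have m3 : AEStronglyMeasurable (fun p : ℝ × ℝ => (((1 + p.1) ^ (-k) : ℝ) : ℂ))
          ((volume.restrict (Ioi (0 : ℝ))).prod (volume.restrict (Ioi (0 : ℝ)))) :=
        m2.comp_fst
      have m4 : Continuous fun p : ℝ × ℝ =>
          Complex.exp (-((x / 2 * (2 * p.1 + 1) : ℝ) : ℂ) * p.2) := by fun_prop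
      exact (m4.aestronglyMeasurable.mul m1).mul m3
    · rw [Measure.prod_restrict]
      refine (ae_restrict_iff' (measurableSet_Ioi.prod measurableSet_Ioi)).2
        (ae_of_all _ fun p ⟨(hp1 : 0 < p.1), (hp2 : 0 < p.2)⟩ => ?_)
      simp only [Function.uncurry, f]
      by_cases h0 : ψ p.2 = 0
      · simp [h0]
      have h2 := (h _ hp2 h0).1
      rw [norm_mul, norm_mul, Complex.norm_exp, Complex.norm_real,
        Real.norm_of_nonneg (by positivity)]
      have h3 : (-((x / 2 * (2 * p.1 + 1) : ℝ) : ℂ) * (p.2 : ℂ)).re ≤ -(x * a) * p.1 := by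
        rw [← Complex.ofReal_neg, ← Complex.ofReal_mul, Complex.ofReal_re]
        nlinarith [mul_pos hx hp2, mul_le_mul_of_nonneg_left h2 (mul_pos hx hp1).le]
      calc _ ≤ Real.exp (-(x * a) * p.1) * ‖ψ p.2‖ * (1 + p.1) ^ (-k) := by gcongr
        _ = _ := by ring
  have hswap := integral_integral_swap hf
  have hl : ∫ t in Ioi (0 : ℝ), laplace ψ ((x / 2 * (2 * t + 1) : ℝ) : ℂ) / (((1 + t) ^ k : ℝ) : ℂ)
      = ∫ t in Ioi (0 : ℝ), ∫ y in Ioi (0 : ℝ), f t y := by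
    refine setIntegral_congr_fun measurableSet_Ioi fun t (ht : 0 < t) => ?_
    simp only [f]
    rw [integral_mul_const, laplace, Real.rpow_neg (by positivity), Complex.ofReal_inv,
      div_eq_mul_inv]
  rw [hl, hswap, ← integral_const_mul]
  refine setIntegral_congr_fun measurableSet_Ioi fun y (hy : 0 < y) => ?_
  have hin : ∫ t in Ioi (0 : ℝ), f t y = Complex.exp (-(x / 2 * y)) * ψ y *
      gammaKernel k ((x * y : ℝ) : ℂ) := by
    rw [gammaKernel, ← integral_const_mul]
    refine integral_congr_ae (ae_of_all _ fun t => ?_)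
    simp only [f]
    have : Complex.exp (-((x / 2 * (2 * t + 1) : ℝ) : ℂ) * y) =
        Complex.exp (-(x / 2 * y)) * Complex.exp (-((x * y : ℝ) : ℂ) * t) := by
      rw [← Complex.exp_add]; push_cast; ring_nf
    rw [this]
    ring
  have hψy : ψ y = φ y * ((y ^ (1 - k) : ℝ) : ℂ) := by
    rw [hψ, twist, Complex.ofReal_cpow hy.le]
    push_cast
    ring_nf
  have hexp : Complex.exp (-(Complex.I * x / 2) * (y * Complex.I)) * Complex.exp (-(x * y)) =
      Complex.exp (-(x / 2 * y)) := by
    rw [← Complex.exp_add]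
    congr 1
    linear_combination (-(x * y / 2) : ℂ) * Complex.I_sq
  rw [hin, hψy, ← cIncGamma_ofReal k (mul_pos hx hy), cIncGamma, ← hexp,
    ← Complex.ofReal_cpow (mul_pos hx hy).le, Real.mul_rpow hx.le hy.le]
  push_cast
  ring

lemma hasSum_mul_integral_laplace {ι : Type*} [Countable ι] (k : ℝ) {x : ι → ℝ} {c : ι → ℂ}
    {φ : ℝ → ℂ} (hφ : IsCompactIntegrable φ) {x₀ : ℝ} (hx₀ : 0 < x₀) (hxx₀ : ∀ i, x₀ ≤ x i)
    (hx : FreqSummable x) (hc : Subexp x c) :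
    HasSum (fun i => c i * (((x i ^ (1 - k) : ℝ) : ℂ) * ∫ t in Ioi (0 : ℝ),
      laplace (twist φ (2 - k)) ((x i / 2 * (2 * t + 1) : ℝ) : ℂ) / (((1 + t) ^ k : ℝ) : ℂ)))
      (∫ y in Ioi (0 : ℝ), nonholSeries k x c (y * Complex.I) * φ y) := by
  have hxpos : ∀ i, 0 < x i := fun i => hx₀.trans_le (hxx₀ i)
  have him : ∀ y : ℝ, ((y : ℂ) * Complex.I).im = y := by simp
  simp_rw [nonholSeries, him]
  convert! hasSum_integral_mul_of_bound (T := fun i (y : ℝ) =>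
    c i * (incGamma (1 - k) (x i * y) : ℂ) *
      Complex.exp (-(Complex.I * x i / 2) * (y * Complex.I))) hφ (fun i => ?_) ?_ using 2
    with i
  · rw [integral_laplace_eq k (hxpos i) hφ, ← integral_const_mul]
    simp only [mul_assoc]
  · refine ContinuousOn.mul (continuousOn_const.mul ?_) (by fun_prop)
    refine Complex.continuous_ofReal.comp_continuousOn fun y (hy : 0 < y) => ?_
    have h1 := (hasDerivAt_incGamma (1 - k) (mul_pos (hxpos i) hy)).continuousAt
    exact (ContinuousAt.comp (f := fun y => x i * y) h1 (by fun_prop)).continuousWithinAt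
  · intro a b ha hab
    -- With $\delta=\frac14$ the gamma factor is $O(e^{-3x_iy/4})$. Against the growing $e^{x_iy/2}$
    -- this leaves $e^{-x_iy/4}$, hence the frequencies $x_i/4$ below.
    obtain ⟨C, hC, hcC⟩ := norm_cIncGamma_le k (ε := x₀ * a) (δ := 1 / 4) (by positivity)
      (by norm_num)
    obtain ⟨u, hu, h⟩ := exists_summable_bound_holSeries
      (hx.const_mul (s := 1 / 4) (by norm_num)) (hc.comp_const_mul (s := 1 / 4) (by norm_num))
      ha hab
    refine ⟨fun i => C * u i, hu.mul_left C, fun i y h1 h2 => ?_⟩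
    have hy : 0 < y := ha.trans_le h1
    have hxy := mul_pos (hxpos i) hy
    have h3 := hcC ((x i * y : ℝ) : ℂ) (by
      rw [Complex.ofReal_re]
      exact mul_le_mul (hxx₀ i) h1 ha.le (hxpos i).le)
    rw [cIncGamma_ofReal k hxy, Complex.norm_real (x i * y), Real.norm_of_nonneg hxy.le,
      Complex.ofReal_re] at h3
    have h4 : ‖Complex.exp (-(Complex.I * x i / 2) * (y * Complex.I))‖ =
        Real.exp (x i * y / 2) := by
      rw [Complex.norm_exp]
      congr 1
      have : -(Complex.I * x i / 2) * (y * Complex.I) = ((x i * y / 2 : ℝ) : ℂ) := by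
        push_cast; linear_combination (-(x i * y / 2) : ℂ) * Complex.I_sq
      rw [this, Complex.ofReal_re]
    rw [norm_mul, norm_mul, h4]
    calc _ ≤ ‖c i‖ * (C * Real.exp (1 / 4 * (x i * y) - x i * y)) * Real.exp (x i * y / 2) := by
          gcongr
      _ = C * (‖c i‖ * Real.exp (-(1 / 4 * x i * y))) := by
          rw [mul_assoc, mul_assoc, ← Real.exp_add]; ring_nf
      _ ≤ C * u i := by gcongr; exact h i y h1 h2

/-! ### Test spaces separate continuous functions -/

/-- By Weierstrass approximation on the compact interval carrying $\psi$, vanishing moments force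
$\psi$ to integrate to zero against every smooth compactly supported function. -/
lemma ae_eq_zero_of_integral_pow_mul_eq_zero {ψ : ℝ → ℂ} (hψ : IsCompactIntegrable ψ)
    (h : ∀ n : ℕ, ∫ y in Ioi (0 : ℝ), ((y : ℂ) ^ n) * ψ y = 0) :
    ∀ᵐ y ∂(volume.restrict (Ioi (0 : ℝ))), ψ y = 0 := by
  have hψ' := hψ
  obtain ⟨hi, a, b, ha, hab, hs⟩ := hψ'
  refine ae_eq_zero_of_integral_contDiff_smul_eq_zero (Integrable.locallyIntegrable hi)
    fun g hg _ => ?_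
  have hpoly : ∀ p : Polynomial ℝ, ∫ y in Ioi (0 : ℝ), p.eval y • ψ y = 0 := by
    intro p
    have : ∀ y : ℝ, p.eval y • ψ y =
        ∑ i ∈ Finset.range (p.natDegree + 1), (p.coeff i : ℂ) * ((y : ℂ) ^ i * ψ y) := fun y => by
      rw [Polynomial.eval_eq_sum_range, Complex.real_smul]
      push_cast
      rw [Finset.sum_mul]
      exact Finset.sum_congr rfl fun i _ => mul_assoc _ _ _
    simp_rw [this]
    rw [integral_finsetSum _ fun i _ =>
      ((hψ.continuousOn_mul (q := fun y => (y : ℂ) ^ i) (by fun_prop)).1.const_mul _)]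
    exact Finset.sum_eq_zero fun i _ => by rw [integral_const_mul, h, mul_zero]
  have hgi : IntegrableOn (fun y => g y • ψ y) (Ioi 0) := by
    simpa only [Complex.real_smul] using (hψ.continuousOn_mul (q := fun y => (g y : ℂ))
      (Complex.continuous_ofReal.comp hg.continuous).continuousOn).1
  by_contra hne
  set N := ∫ y in Ioi (0 : ℝ), ‖ψ y‖ with hN
  have hN0 : 0 ≤ N := integral_nonneg fun y => norm_nonneg _
  set I := ∫ y in Ioi (0 : ℝ), g y • ψ y with hI
  have hIpos : 0 < ‖I‖ := norm_pos_iff.2 hne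
  -- This precision gives $\|I\|\le\|I\|N/(N+1)$, impossible for $I\ne0$; the $+1$ also covers
  -- $N=0$.
  obtain ⟨p, hp⟩ := exists_polynomial_near_of_continuousOn a b g hg.continuous.continuousOn
    (‖I‖ / (N + 1)) (by positivity)
  have hpi : IntegrableOn (fun y => p.eval y • ψ y) (Ioi 0) := by
    simpa only [Complex.real_smul] using (hψ.continuousOn_mul (q := fun y => ((p.eval y : ℝ) : ℂ))
      (Complex.continuous_ofReal.comp p.continuous).continuousOn).1
  have h1 : I = ∫ y in Ioi (0 : ℝ), (g y • ψ y - p.eval y • ψ y) := by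
    rw [integral_sub hgi hpi, hpoly, sub_zero]
  have h2 : ‖I‖ ≤ ‖I‖ / (N + 1) * N := by
    conv_lhs => rw [h1]
    rw [hN, ← integral_const_mul]
    refine norm_integral_le_of_norm_le (hi.norm.const_mul _)
      ((ae_restrict_iff' measurableSet_Ioi).2 (ae_of_all _ fun y hy => ?_))
    by_cases h0 : ψ y = 0
    · simp [h0]
    · rw [← sub_smul, norm_smul, Real.norm_eq_abs, abs_sub_comm]
      gcongr
      exact (hp y (hs y hy h0)).le
  rw [div_mul_eq_mul_div, le_div_iff₀ (by positivity)] at h2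
  nlinarith

/-- For one $\varphi$ with $\varphi(x)\ne0$, the twists $\varphi(y)y^n$ stay in the space, so all
moments of $G\varphi$ vanish and $G\varphi=0$ almost everywhere. -/
lemma IsTestSpace.eq_zero_of_integral_eq_zero {Sc : Set (ℝ → ℂ)} (hSc : IsTestSpace Sc) {G : ℝ → ℂ}
    (hG : ContinuousOn G (Ioi 0))
    (h : ∀ φ ∈ Sc, ∫ y in Ioi (0 : ℝ), G y * φ y = 0) {x : ℝ} (hx : 0 < x) : G x = 0 := by
  obtain ⟨φ, hφ, hφx⟩ := hSc.exists_ne_zero x hx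
  have hφi := (hSc.isTestFunction φ hφ).isCompactIntegrable
  have hae := ae_eq_zero_of_integral_pow_mul_eq_zero (hφi.continuousOn_mul hG) fun n => by
    rw [← h _ (hSc.twist_mem φ hφ (n + 1))]
    refine integral_congr_ae (ae_of_all _ fun y => ?_)
    simp only [twist, add_sub_cancel_right, Complex.cpow_natCast]
    ring
  rw [ae_restrict_iff' measurableSet_Ioi] at hae
  by_contra hne
  obtain ⟨ε, hε, g, r, hg, hr, hgl, hrr, hv⟩ :=
    (hSc.isTestFunction φ hφ).piecewiseSmooth x hx
  have hx' : Ioo (x - ε) (x + ε) ∈ 𝓝 x := Ioo_mem_nhds (by linarith) (by linarith)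
  have hG1 : ∀ᶠ y in 𝓝 x, G y ≠ 0 ∧ 0 < y :=
    ((hG.continuousAt (Ioi_mem_nhds hx)).eventually_ne hne).and (Ioi_mem_nhds hx)
  have key : ∀ (q : ℝ → ℂ), ContDiffOn ℝ ∞ q (Ioo (x - ε) (x + ε)) → q x ≠ 0 →
      ∃ δ > 0, δ < ε ∧ ∀ y ∈ Ioo (x - δ) (x + δ), q y ≠ 0 ∧ G y ≠ 0 ∧ 0 < y := by
    intro q hq hqx
    have h1 := ((hq.continuousOn.continuousAt hx').eventually_ne hqx).and hG1
    obtain ⟨δ, hδ, h2⟩ := Metric.eventually_nhds_iff_ball.1 h1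
    refine ⟨min δ (ε / 2), by positivity, by linarith [min_le_right δ (ε / 2)], fun y hy => h2 y ?_⟩
    rw [Real.ball_eq_Ioo]
    exact ⟨by linarith [hy.1, min_le_left δ (ε / 2)], by linarith [hy.2, min_le_left δ (ε / 2)]⟩
  have fin : ∀ s t : ℝ, s < t → (∀ y ∈ Ioo s t, 0 < y ∧ G y * φ y ≠ 0) → False := by
    intro s t hst hy
    have h0 : volume (Ioo s t) = 0 :=
      measure_mono_null (t := {y | ¬(y ∈ Ioi 0 → G y * φ y = 0)})
        (fun y hy' h' => (hy y hy').2 (h' (hy y hy').1)) hae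
    rw [Real.volume_Ioo, ENNReal.ofReal_eq_zero] at h0
    linarith
  -- Since $\varphi(x)$ is a one-sided limit, $\varphi$ is nonzero on a whole interval on that side
  -- of $x$. If $G(x)\ne0$, then $G\varphi\ne0$ on a set of positive measure.
  rcases hv with hv | hv
  · obtain ⟨δ, hδ, hδε, hk⟩ := key g hg (hv ▸ hφx)
    refine fin (x - δ) x (by linarith) fun y hy => ?_
    obtain ⟨h1, h2, h3⟩ := hk y ⟨hy.1, by linarith [hy.2]⟩
    exact ⟨h3, mul_ne_zero h2 (by rwa [hgl y ⟨by linarith [hy.1], hy.2⟩])⟩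
  · obtain ⟨δ, hδ, hδε, hk⟩ := key r hr (hv ▸ hφx)
    refine fin x (x + δ) (by linarith) fun y hy => ?_
    obtain ⟨h1, h2, h3⟩ := hk y ⟨by linarith [hy.1], hy.2⟩
    exact ⟨h3, mul_ne_zero h2 (by rwa [hrr y ⟨hy.1, by linarith [hy.2]⟩])⟩

/-! ### Sums of a holomorphic and a nonholomorphic series -/

section Mixed

variable {ι₁ ι₂ : Type*}

/-- The sum of `holSeries x c` and `nonholSeries k y d`. -/
def mixedSeries (k : ℝ) (x : ι₁ → ℝ) (c : ι₁ → ℂ) (y : ι₂ → ℝ) (d : ι₂ → ℂ) (z : ℂ) : ℂ :=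
  holSeries x c z + nonholSeries k y d z

/-- The holomorphic function `H` with `∂f/∂τ̄ = v^{-k} H(-τ̄)` for `f = nonholSeries k y d`. -/
def shadowSeries (k : ℝ) (y : ι₂ → ℝ) (d : ι₂ → ℂ) : ℂ → ℂ :=
  holSeries (fun i => 1 / 2 * y i) fun i => Complex.I / 2 * (-((y i ^ (1 - k) : ℝ) : ℂ) * d i)

variable {k : ℝ} {x : ι₁ → ℝ} {c : ι₁ → ℂ} {y : ι₂ → ℝ} {d : ι₂ → ℂ} {y₀ : ℝ}

lemma subexp_shadow (hy₀ : 0 < y₀) (hyy₀ : ∀ i, y₀ ≤ y i) (hd : Subexp y d) :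
    Subexp (fun i => 1 / 2 * y i) fun i => -((y i ^ (1 - k) : ℝ) : ℂ) * d i := by
  have := (((subexp_rpow hy₀ hyy₀ (1 - k)).mul hd).const_mul (-1)).comp_const_mul
    (s := 1 / 2) (by norm_num)
  convert! this using 2
  ring

lemma differentiableAt_shadowSeries (hy₀ : 0 < y₀) (hyy₀ : ∀ i, y₀ ≤ y i) (hy : FreqSummable y)
    (hd : Subexp y d) {z : ℂ} (hz : 0 < z.im) : DifferentiableAt ℂ (shadowSeries k y d) z :=
  (hasDerivAt_holSeries (hy.const_mul (by norm_num))
    ((subexp_shadow hy₀ hyy₀ hd).const_mul _) hz).differentiableAt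

lemma summable_nonholSeries (hy₀ : 0 < y₀) (hyy₀ : ∀ i, y₀ ≤ y i) (hy : FreqSummable y)
    (hd : Subexp y d) {z : ℂ} (hz : 0 < z.im) :
    Summable fun i => d i * (incGamma (1 - k) (y i * z.im) : ℂ) *
      Complex.exp (-(Complex.I * y i / 2) * z) := by
  obtain ⟨G, -, hG, -⟩ := exists_analytic_nonholSeries k hy₀ hyy₀ hy hd hz
  exact hG.self_of_nhds.summable

/-- Near $z$ the function is a holomorphic one plus $w\mapsto G(w,\mathrm{Im}\,w)$. The direction
$1$ does not move the second slot, so $\partial/\partial u$ acts termwise on the exponentials; the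
first slot is holomorphic, so only $\frac i2\partial_2G$ survives in the $\bar\tau$-part. -/
lemma mixedSeries_spec (hy₀ : 0 < y₀) (hyy₀ : ∀ i, y₀ ≤ y i) (hx : FreqSummable x)
    (hc : Subexp x c) (hy : FreqSummable y) (hd : Subexp y d) {z : ℂ} (hz : 0 < z.im) :
    AnalyticAt ℝ (mixedSeries k x c y d) z ∧
    fderiv ℝ (mixedSeries k x c y d) z 1 = mixedSeries k x (fun i => Complex.I * x i * c i) y
      (fun i => -(Complex.I * y i / 2) * d i) z ∧
    barPart (fderiv ℝ (mixedSeries k x c y d) z) =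
      ((z.im ^ (-k) : ℝ) : ℂ) • shadowSeries k y d (-(starRingEnd ℂ) z) := by
  obtain ⟨G, hGa, hGs, hG1, hG2⟩ := exists_analytic_nonholSeries k hy₀ hyy₀ hy hd hz
  have hopen : IsOpen {z : ℂ | 0 < z.im} := isOpen_lt continuous_const Complex.continuous_im
  have hh := hasDerivAt_holSeries hx hc hz
  have hha : AnalyticAt ℂ (holSeries x c) z :=
    DifferentiableOn.analyticAt (s := {z : ℂ | 0 < z.im}) (fun w hw =>
      (hasDerivAt_holSeries hx hc hw).differentiableAt.differentiableWithinAt) (hopen.mem_nhds hz)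
  let ℓ : ℂ →L[ℝ] ℂ × ℂ :=
    (ContinuousLinearMap.id ℝ ℂ).prod (Complex.ofRealCLM.comp Complex.imCLM)
  have hℓ : ∀ w : ℂ, ℓ w = (w, (w.im : ℂ)) := fun w => rfl
  have hev : mixedSeries k x c y d =ᶠ[𝓝 z] fun w => holSeries x c w + G (ℓ w) := by
    filter_upwards [hGs] with w hw
    rw [mixedSeries, hℓ, nonholSeries, hw.tsum_eq]
  have hGa' : AnalyticAt ℝ G (ℓ z) := hGa.restrictScalars
  refine ⟨(hha.restrictScalars.add (hGa'.comp (ℓ.analyticAt z))).congr hev.symm, ?_⟩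
  have hd1 : HasFDerivAt (mixedSeries k x c y d) _ z :=
    ((hh.hasFDerivAt.restrictScalars ℝ).add
      (((hGa.differentiableAt.hasFDerivAt.restrictScalars ℝ : HasFDerivAt G _ (ℓ z))).comp z
        ℓ.hasFDerivAt)).congr_of_eventuallyEq hev
  have hval : ∀ w, fderiv ℝ (mixedSeries k x c y d) z w =
      w * holSeries x (fun i => Complex.I * x i * c i) z +
        fderiv ℂ G (z, z.im) (w, (w.im : ℂ)) := fun w => by
    rw [hd1.fderiv]
    simp [hℓ]
  have e1 : fderiv ℝ (mixedSeries k x c y d) z 1 =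
      mixedSeries k x (fun i => Complex.I * x i * c i) y
      (fun i => -(Complex.I * y i / 2) * d i) z := by
    rw [hval, mixedSeries, ← hG1]
    simp
  refine ⟨e1, ?_⟩
  have e2 : ((Complex.I, (Complex.I.im : ℂ)) : ℂ × ℂ) = Complex.I • (1, 0) + (0, 1) := by
    simp
  rw [barPart, e1, hval, e2, map_add, map_smul, hG1, hG2, mixedSeries, shadowSeries, holSeries,
    holSeries, holSeries]
  simp_rw [mul_assoc (Complex.I / 2)]
  rw [tsum_mul_left]
  simp only [smul_eq_mul]
  linear_combination ((1 / 2 : ℂ) * (∑' i, Complex.I * x i * c i * Complex.exp (Complex.I * x i * z)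
    + nonholSeries k y (fun i => -(Complex.I * y i / 2) * d i) z)) * Complex.I_sq

end Mixed

/-! ### The frequencies `2π(n + κ)` and `-4π(n + κ)` -/

/-- The frequencies `2π(n + κ)`, `n ≥ -n₀`, of the holomorphic part. -/
def holFreq (n₀ : ℕ) (κ : ℝ) (n : {n : ℤ // -(n₀ : ℤ) ≤ n}) : ℝ := 2 * Real.pi * (((n : ℤ) : ℝ) + κ)

/-- The frequencies `-4π(n + κ)`, `n + κ < 0`, of the nonholomorphic part. -/
def nonholFreq (κ : ℝ) (n : {n : ℤ // (n : ℝ) + κ < 0}) : ℝ := -4 * Real.pi * (((n : ℤ) : ℝ) + κ)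

lemma neg_of_add_neg {κ : ℝ} (hκ : 0 ≤ κ) (n : {n : ℤ // (n : ℝ) + κ < 0}) : (n : ℤ) ≤ -1 := by
  have h := n.2
  have : ((n : ℤ) : ℝ) < 0 := by linarith
  have : (n : ℤ) < 0 := by exact_mod_cast this
  omega

lemma le_holFreq {n₀ : ℕ} {κ : ℝ} (hκ : 0 ≤ κ) (n : {n : ℤ // -(n₀ : ℤ) ≤ n}) :
    -(2 * Real.pi * n₀) ≤ holFreq n₀ κ n := by
  have h : (-(n₀ : ℤ) : ℝ) ≤ ((n : ℤ) : ℝ) := by exact_mod_cast n.2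
  have := mul_le_mul_of_nonneg_left (add_le_add h hκ) (show (0 : ℝ) ≤ 2 * Real.pi by positivity)
  simpa [holFreq] using this

/-- For $\kappa<1$ this bound is positive and keeps the arguments of $\Gamma(1-k,\cdot)$ away from
its possible singularity at $0$. -/
lemma le_nonholFreq {κ : ℝ} (hκ : 0 ≤ κ) (n : {n : ℤ // (n : ℝ) + κ < 0}) :
    4 * Real.pi * (1 - κ) ≤ nonholFreq κ n := by
  have h : ((n : ℤ) : ℝ) ≤ -1 := by exact_mod_cast neg_of_add_neg hκ n
  have h2 : 1 - κ ≤ -(((n : ℤ) : ℝ) + κ) := by linarith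
  have := mul_le_mul_of_nonneg_left h2 (show (0 : ℝ) ≤ 4 * Real.pi by positivity)
  rw [nonholFreq]
  linarith

lemma freqSummable_of_injective {ι : Type*} {x : ι → ℝ} {s B : ℝ} (hs : 0 < s) (e : ι → ℕ)
    (he : Function.Injective e) (h : ∀ i, s * e i ≤ x i + B) : FreqSummable x := fun ε hε => by
  have h1 : Summable fun n : ℕ => Real.exp (ε * B) * Real.exp (-(ε * s)) ^ n :=
    (summable_geometric_of_lt_one (Real.exp_nonneg _)
      (by simpa using mul_pos hε hs)).mul_left _
  refine Summable.of_nonneg_of_le (fun i => Real.exp_nonneg _) (fun i => ?_) (h1.comp_injective he)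
  simp only [Function.comp_apply]
  rw [← Real.exp_nat_mul, ← Real.exp_add, Real.exp_le_exp]
  nlinarith [h i]

lemma freqSummable_holFreq (n₀ : ℕ) {κ : ℝ} (hκ : 0 ≤ κ) : FreqSummable (holFreq n₀ κ) := by
  refine freqSummable_of_injective (s := 2 * Real.pi) (B := 2 * Real.pi * n₀) (by positivity)
    (fun n => ((n : ℤ) + n₀).toNat) (fun a b hab => Subtype.ext ?_) fun n => ?_
  · have := a.2; have := b.2
    simp only at hab
    omega
  · have h : ((((n : ℤ) + n₀).toNat : ℕ) : ℝ) = ((n : ℤ) : ℝ) + n₀ := by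
      have : ((((n : ℤ) + n₀).toNat : ℕ) : ℤ) = (n : ℤ) + n₀ :=
        Int.toNat_of_nonneg (by have := n.2; omega)
      exact_mod_cast this
    rw [h, holFreq]
    nlinarith [Real.pi_pos]

lemma freqSummable_nonholFreq {κ : ℝ} (hκ : 0 ≤ κ) : FreqSummable (nonholFreq κ) := by
  refine freqSummable_of_injective (s := 4 * Real.pi) (B := 4 * Real.pi * κ) (by positivity)
    (fun n => (-(n : ℤ)).toNat) (fun a b hab => Subtype.ext ?_) fun n => ?_
  · have := neg_of_add_neg hκ a; have := neg_of_add_neg hκ b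
    simp only at hab
    omega
  · have h : (((-(n : ℤ)).toNat : ℕ) : ℝ) = -((n : ℤ) : ℝ) := by
      have : (((-(n : ℤ)).toNat : ℕ) : ℤ) = -(n : ℤ) :=
        Int.toNat_of_nonneg (by have := neg_of_add_neg hκ n; omega)
      exact_mod_cast this
    rw [h, nonholFreq]
    linarith

lemma tendsto_cofinite_atTop_coe (n₀ : ℕ) :
    Tendsto (fun n : {n : ℤ // -(n₀ : ℤ) ≤ n} => (n : ℤ)) cofinite atTop := by
  refine tendsto_atTop.2 fun b => ?_
  refine Set.Finite.subset ((Set.finite_Icc (-(n₀ : ℤ)) b).preimage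
    (f := fun n : {n : ℤ // -(n₀ : ℤ) ≤ n} => (n : ℤ)) Subtype.val_injective.injOn) fun n hn => ?_
  have : ¬ b ≤ (n : ℤ) := hn
  exact ⟨n.2, (not_le.1 this).le⟩

lemma tendsto_cofinite_atBot_coe {κ : ℝ} (hκ : 0 ≤ κ) :
    Tendsto (fun n : {n : ℤ // (n : ℝ) + κ < 0} => (n : ℤ)) cofinite atBot := by
  refine tendsto_atBot.2 fun b => ?_
  refine Set.Finite.subset ((Set.finite_Icc b (-1)).preimage
    (f := fun n : {n : ℤ // (n : ℝ) + κ < 0} => (n : ℤ)) Subtype.val_injective.injOn) fun n hn => ?_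
  have : ¬ (n : ℤ) ≤ b := hn
  exact ⟨(not_le.1 this).le, neg_of_add_neg hκ n⟩

lemma subexp_of_isBigO {ι : Type*} {l : Filter ℤ} {x : ι → ℝ} {e : ι → ℤ}
    (he : Tendsto e cofinite l) {s B C : ℝ} (hs : 0 < s)
    (hx : ∀ᶠ i in cofinite, s * |(e i : ℝ)| ≤ x i + B) {c : ℤ → ℂ}
    (hc : c =O[l] fun n : ℤ => Real.exp (C * Real.sqrt |(n : ℝ)|)) :
    Subexp x fun i => c (e i) := fun ε hε => by
  have h1 : (fun i => Real.exp (C * Real.sqrt |(e i : ℝ)|)) =O[cofinite]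
      fun i => Real.exp (ε * x i) := by
    -- With $t=\sqrt{|n|}$, completing the square gives $Ct\le C^2/(4\varepsilon s)+\varepsilon
    -- s\,t^2$, and $s\,t^2\le x_i+B$.
    refine Asymptotics.IsBigO.of_bound (Real.exp (C ^ 2 / (4 * (ε * s)) + ε * B)) ?_
    filter_upwards [hx] with i hi
    rw [Real.norm_of_nonneg (Real.exp_nonneg _), Real.norm_of_nonneg (Real.exp_nonneg _),
      ← Real.exp_add, Real.exp_le_exp]
    set t := Real.sqrt |(e i : ℝ)| with ht
    have ht2 : t ^ 2 = |(e i : ℝ)| := Real.sq_sqrt (abs_nonneg _)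
    have hδ : 0 < ε * s := mul_pos hε hs
    have h2 : C * t ≤ C ^ 2 / (4 * (ε * s)) + ε * s * t ^ 2 := by
      rw [div_add' _ _ _ (by positivity), le_div_iff₀ (by positivity)]
      nlinarith [sq_nonneg (C - 2 * (ε * s) * t)]
    rw [ht2] at h2
    nlinarith
  have h2 := (hc.comp_tendsto he).trans h1
  -- The comparison function never vanishes, so a bound outside a finite set becomes a bound at
  -- every index after enlarging the constant.
  rw [Asymptotics.isBigO_cofinite_iff fun i hi => (Real.exp_ne_zero _ hi).elim] at h2
  obtain ⟨K, hK⟩ := h2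
  refine ⟨max K 0, le_max_right _ _, fun i => (hK i).trans ?_⟩
  rw [Real.norm_of_nonneg (Real.exp_nonneg _)]
  gcongr
  exact le_max_left _ _

lemma subexp_holFreq (n₀ : ℕ) {κ : ℝ} (hκ : 0 ≤ κ) {c : ℤ → ℂ} {C : ℝ}
    (hc : c =O[atTop] fun n : ℤ => Real.exp (C * Real.sqrt |(n : ℝ)|)) :
    Subexp (holFreq n₀ κ) fun n => c n := by
  refine subexp_of_isBigO (tendsto_cofinite_atTop_coe n₀) (s := 2 * Real.pi) (B := 0)
    (by positivity) ?_ hc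
  filter_upwards [(tendsto_cofinite_atTop_coe n₀).eventually_ge_atTop 0] with n hn
  have : (0 : ℝ) ≤ ((n : ℤ) : ℝ) := by exact_mod_cast hn
  rw [abs_of_nonneg this, holFreq]
  nlinarith [Real.pi_pos, mul_nonneg Real.pi_pos.le hκ]

lemma subexp_nonholFreq {κ : ℝ} (hκ : 0 ≤ κ) {c : ℤ → ℂ} {C : ℝ}
    (hc : c =O[atBot] fun n : ℤ => Real.exp (C * Real.sqrt |(n : ℝ)|)) :
    Subexp (nonholFreq κ) fun n => c n := by
  refine subexp_of_isBigO (tendsto_cofinite_atBot_coe hκ) (s := 4 * Real.pi) (B := 4 * Real.pi * κ)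
    (by positivity) (Eventually.of_forall fun n => ?_) hc
  have h : ((n : ℤ) : ℝ) ≤ -1 := by exact_mod_cast neg_of_add_neg hκ n
  rw [abs_of_neg (by linarith), nonholFreq]
  linarith

lemma holTerm_eq (n₀ : ℕ) (κ : ℝ) (c : ℤ → ℂ) (τ : UpperHalfPlane)
    (n : {n : ℤ // -(n₀ : ℤ) ≤ n}) :
    holTerm κ c τ n = c n * Complex.exp (Complex.I * holFreq n₀ κ n * τ) := by
  rw [holTerm, holFreq]
  push_cast
  ring_nf

lemma nonholTerm_eq (k κ : ℝ) (c : ℤ → ℂ) (τ : UpperHalfPlane)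
    (n : {n : ℤ // (n : ℝ) + κ < 0}) :
    nonholTerm k κ c τ n = c n * (incGamma (1 - k) (nonholFreq κ n * (τ : ℂ).im) : ℂ) *
      Complex.exp (-(Complex.I * nonholFreq κ n / 2) * τ) := by
  rw [nonholTerm, nonholFreq]
  congr 2
  push_cast
  ring

/-- The series `maassSeries` as a function on `ℂ`. -/
def maassFun {m : ℕ} (k : ℝ) (κ : Fin m → ℝ) (n₀ : ℕ) (cp cm : Fin m → ℤ → ℂ) (z : ℂ) :
    Fin m → ℂ := fun j =>
  mixedSeries k (holFreq n₀ (κ j)) (fun n => cp j n) (nonholFreq (κ j)) (fun n => cm j n) z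

lemma maassSeries_eq {m : ℕ} (k : ℝ) (κ : Fin m → ℝ) (n₀ : ℕ) (cp cm : Fin m → ℤ → ℂ)
    (τ : UpperHalfPlane) : maassSeries k κ n₀ cp cm τ = maassFun k κ n₀ cp cm τ := by
  funext j
  simp only [maassSeries, maassFun, mixedSeries, holSeries, nonholSeries, holTerm_eq,
    nonholTerm_eq]

/-! ### The function `f` on the upper half plane -/

section Maass

variable {m : ℕ} {κ : Fin m → ℝ} {n₀ : ℕ} {cp cm : Fin m → ℤ → ℂ}

/-- The coefficients grow subexponentially. -/
structure SubexpCoeffs (κ : Fin m → ℝ) (n₀ : ℕ) (cp cm : Fin m → ℤ → ℂ) : Prop where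
  hol : ∀ j, Subexp (holFreq n₀ (κ j)) fun n => cp j n
  nonhol : ∀ j, Subexp (nonholFreq (κ j)) fun n => cm j n

/-- The coefficients of `(2πi)⁻¹ ∂f/∂u`. -/
def derivCoeff (κ : Fin m → ℝ) (c : Fin m → ℤ → ℂ) (j : Fin m) (n : ℤ) : ℂ :=
  c j n * (((n : ℝ) + κ j : ℝ) : ℂ)

lemma nonholFreq_pos_bound (hκ : ∀ j, 0 ≤ κ j ∧ κ j < 1) (j : Fin m) :
    0 < 4 * Real.pi * (1 - κ j) :=
  mul_pos (by positivity) (sub_pos.2 (hκ j).2)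

lemma SubexpCoeffs.deriv (hκ : ∀ j, 0 ≤ κ j ∧ κ j < 1) (h : SubexpCoeffs κ n₀ cp cm) :
    SubexpCoeffs κ n₀ (derivCoeff κ cp) (derivCoeff κ cm) := by
  refine ⟨fun j => ?_, fun j => ?_⟩
  · convert! (((h.hol j).mul (subexp_ofReal fun n => le_holFreq (hκ j).1 n)).const_mul
      ((2 * Real.pi : ℂ)⁻¹)) using 2 with n
    have : (Real.pi : ℂ) ≠ 0 := by exact_mod_cast Real.pi_ne_zero
    rw [derivCoeff, holFreq]
    push_cast
    field_simp
  · convert! (((h.nonhol j).mul (subexp_ofReal fun n => le_nonholFreq (hκ j).1 n)).const_mul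
      ((-4 * Real.pi : ℂ)⁻¹)) using 2 with n
    have : (Real.pi : ℂ) ≠ 0 := by exact_mod_cast Real.pi_ne_zero
    rw [derivCoeff, nonholFreq]
    push_cast
    field_simp

variable (hκ : ∀ j, 0 ≤ κ j ∧ κ j < 1) (h : SubexpCoeffs κ n₀ cp cm)

include hκ h in
-- The gamma factors do not depend on $u$, so $\partial/\partial u$ multiplies every coefficient by
-- $2\pi i(n+\kappa_j)$ and the derivative is a series of the same shape. This lets the integral
-- formula for $L_f$ serve for $L_{\delta_kf}$ as well.
lemma maassFun_apply_spec (k : ℝ) (j : Fin m) {z : ℂ} (hz : 0 < z.im) :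
    AnalyticAt ℝ (fun w => maassFun k κ n₀ cp cm w j) z ∧
    fderiv ℝ (fun w => maassFun k κ n₀ cp cm w j) z 1 =
      2 * Real.pi * Complex.I * maassFun k κ n₀ (derivCoeff κ cp) (derivCoeff κ cm) z j ∧
    barPart (fderiv ℝ (fun w => maassFun k κ n₀ cp cm w j) z) = ((z.im ^ (-k) : ℝ) : ℂ) •
      shadowSeries k (nonholFreq (κ j)) (fun n => cm j n) (-(starRingEnd ℂ) z) := by
  obtain ⟨h1, h2, h3⟩ := mixedSeries_spec (k := k) (nonholFreq_pos_bound hκ j)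
    (le_nonholFreq (hκ j).1) (freqSummable_holFreq n₀ (hκ j).1) (h.hol j)
    (freqSummable_nonholFreq (hκ j).1) (h.nonhol j) hz
  refine ⟨h1, h2.trans ?_, h3⟩
  simp only [maassFun, mixedSeries, holSeries, nonholSeries]
  rw [mul_add, ← tsum_mul_left, ← tsum_mul_left]
  congr 1
  · refine tsum_congr fun n => ?_
    rw [derivCoeff, holFreq]
    push_cast
    ring
  · refine tsum_congr fun n => ?_
    rw [derivCoeff, nonholFreq]
    push_cast
    ring

include hκ h in
lemma analyticAt_maassFun (k : ℝ) {z : ℂ} (hz : 0 < z.im) :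
    AnalyticAt ℝ (maassFun k κ n₀ cp cm) z :=
  AnalyticAt.pi fun j => (maassFun_apply_spec hκ h k j hz).1

include hκ h in
lemma fderiv_maassFun_apply (k : ℝ) {z : ℂ} (hz : 0 < z.im) (w : ℂ) (j : Fin m) :
    fderiv ℝ (maassFun k κ n₀ cp cm) z w j =
      fderiv ℝ (fun z => maassFun k κ n₀ cp cm z j) z w := by
  have := hasFDerivAt_pi'.1 (analyticAt_maassFun hκ h k hz).differentiableAt.hasFDerivAt j
  rw [this.fderiv]
  rfl

include hκ h in
lemma fderiv_maassFun_one (k : ℝ) {z : ℂ} (hz : 0 < z.im) :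
    fderiv ℝ (maassFun k κ n₀ cp cm) z 1 = (2 * Real.pi * Complex.I : ℂ) •
      maassFun k κ n₀ (derivCoeff κ cp) (derivCoeff κ cm) z := by
  funext j
  rw [fderiv_maassFun_apply hκ h k hz, (maassFun_apply_spec hκ h k j hz).2.1]
  rfl

include hκ h in
lemma barPart_fderiv_maassFun (k : ℝ) {z : ℂ} (hz : 0 < z.im) :
    barPart (fderiv ℝ (maassFun k κ n₀ cp cm) z) = ((z.im ^ (-k) : ℝ) : ℂ) •
      (fun z j => shadowSeries k (nonholFreq (κ j)) (fun n => cm j n) z)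
        (-(starRingEnd ℂ) z) := by
  funext j
  refine Eq.trans ?_ (maassFun_apply_spec hκ h k j hz).2.2
  simp only [barPart, Pi.smul_apply, Pi.add_apply, fderiv_maassFun_apply hκ h k hz]

include hκ h in
lemma differentiableAt_shadow (k : ℝ) {z : ℂ} (hz : 0 < z.im) : DifferentiableAt ℂ
    (fun z j => shadowSeries k (nonholFreq (κ j)) (fun n => cm j n) z) z :=
  differentiableAt_pi.2 fun j => differentiableAt_shadowSeries (nonholFreq_pos_bound hκ j)
    (le_nonholFreq (hκ j).1) (freqSummable_nonholFreq (hκ j).1) (h.nonhol j) hz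

lemma maassFun_add_one (k : ℝ) (z : ℂ) (j : Fin m) : maassFun k κ n₀ cp cm (z + 1) j =
    Complex.exp (2 * Real.pi * Complex.I * (κ j : ℂ)) * maassFun k κ n₀ cp cm z j := by
  have key : ∀ n : ℤ, ∀ z : ℂ, Complex.exp (Complex.I * ((2 * Real.pi * ((n : ℝ) + κ j) : ℝ) : ℂ) *
      (z + 1)) = Complex.exp (2 * Real.pi * Complex.I * (κ j : ℂ)) *
        Complex.exp (Complex.I * ((2 * Real.pi * ((n : ℝ) + κ j) : ℝ) : ℂ) * z) := fun n z => by
    rw [← Complex.exp_add, Complex.exp_eq_exp_iff_exists_int]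
    refine ⟨n, ?_⟩
    push_cast
    ring
  simp only [maassFun, mixedSeries, holSeries, nonholSeries]
  rw [mul_add, ← tsum_mul_left, ← tsum_mul_left]
  congr 1
  · refine tsum_congr fun n => ?_
    rw [holFreq, key]
    ring
  · refine tsum_congr fun n => ?_
    have e : ∀ z : ℂ, -(Complex.I * (nonholFreq (κ j) n : ℂ) / 2) * z =
        Complex.I * ((2 * Real.pi * (((n : ℤ) : ℝ) + κ j) : ℝ) : ℂ) * z := fun z => by
      rw [nonholFreq]; push_cast; ring
    rw [e, e, key, Complex.add_im, Complex.one_im, add_zero]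
    ring

/-! ### The `L`-series as integrals along the imaginary axis -/

include hκ h in
lemma continuousOn_maassFun_mul_I (k : ℝ) (j : Fin m) :
    ContinuousOn (fun y : ℝ => maassFun k κ n₀ cp cm (y * Complex.I) j) (Ioi 0) := by
  intro y (hy : 0 < y)
  have hz : 0 < ((y : ℂ) * Complex.I).im := by simpa using hy
  exact (ContinuousAt.comp (f := fun y : ℝ => (y : ℂ) * Complex.I)
    (maassFun_apply_spec hκ h k j hz).1.continuousAt (by fun_prop)).continuousWithinAt

include hκ h in
-- The function $\psi$ is kept separate because $L_{\delta_kf}$ uses $\varphi_{3-k}$, which agrees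
-- with $(\varphi_2)_{2-k}$ on $(0,\infty)$; the Laplace transform sees only that half-line.
lemma tsum_laplace_eq_integral (k : ℝ) {φ ψ : ℝ → ℂ} (hφ : IsCompactIntegrable φ) (j : Fin m)
    (hψ : ∀ y, 0 < y → ψ y = twist φ (2 - k) y) :
    (∑' n : {n : ℤ // -(n₀ : ℤ) ≤ n},
      cp j n * laplace φ ((2 * Real.pi * (((n : ℤ) : ℝ) + κ j) : ℝ) : ℂ)) +
    (∑' n : {n : ℤ // (n : ℝ) + κ j < 0}, cm j n * nonholKernel k (κ j) ψ n) =
    ∫ y in Ioi (0 : ℝ), maassFun k κ n₀ cp cm (y * Complex.I) j * φ y := by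
  have h1 := hasSum_mul_laplace hφ (freqSummable_holFreq n₀ (hκ j).1) (h.hol j)
  have h2 := hasSum_mul_integral_laplace k hφ (nonholFreq_pos_bound hκ j)
    (le_nonholFreq (hκ j).1) (freqSummable_nonholFreq (hκ j).1) (h.nonhol j)
  have hl : ∀ s, laplace ψ s = laplace (twist φ (2 - k)) s := fun s =>
    setIntegral_congr_fun measurableSet_Ioi fun y hy => by simp only [hψ y hy]
  have e2 : ∀ n : {n : ℤ // (n : ℝ) + κ j < 0}, nonholKernel k (κ j) ψ n =
      ((nonholFreq (κ j) n ^ (1 - k) : ℝ) : ℂ) * ∫ t in Ioi (0 : ℝ),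
        laplace (twist φ (2 - k)) ((nonholFreq (κ j) n / 2 * (2 * t + 1) : ℝ) : ℂ) /
          (((1 + t) ^ k : ℝ) : ℂ) := fun n => by
    rw [nonholKernel, nonholFreq]
    simp_rw [hl]
    congr 3
    funext t
    congr 4
    ring
  have hc1 : ContinuousOn (fun y : ℝ => holSeries (holFreq n₀ (κ j)) (fun n => cp j n)
      (y * Complex.I)) (Ioi 0) := by
    intro y (hy : 0 < y)
    have hz : 0 < ((y : ℂ) * Complex.I).im := by simpa using hy
    exact (ContinuousAt.comp (f := fun y : ℝ => (y : ℂ) * Complex.I)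
      (hasDerivAt_holSeries (freqSummable_holFreq n₀ (hκ j).1) (h.hol j) hz).continuousAt
      (by fun_prop)).continuousWithinAt
  have hc2 : ContinuousOn (fun y : ℝ => nonholSeries k (nonholFreq (κ j)) (fun n => cm j n)
      (y * Complex.I)) (Ioi 0) := by
    convert! (continuousOn_maassFun_mul_I hκ h k j).sub hc1 using 2 with y
    simp [maassFun, mixedSeries]
  simp_rw [e2]
  rw [h2.tsum_eq]
  refine (congrArg (· + _) h1.tsum_eq).trans ?_
  rw [← integral_add (hφ.continuousOn_mul hc1).1 (hφ.continuousOn_mul hc2).1]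
  simp only [maassFun, mixedSeries, add_mul]

include hκ h in
lemma Lf_eq_integral (k : ℝ) {φ : ℝ → ℂ} (hφ : IsCompactIntegrable φ) (j : Fin m) :
    Lf k κ n₀ cp cm φ j = ∫ y in Ioi (0 : ℝ), maassFun k κ n₀ cp cm (y * Complex.I) j * φ y :=
  tsum_laplace_eq_integral hκ h k hφ j fun _ _ => rfl

/-- The function `y ↦ (δ_k f)(iy)`. -/
def deltaFun (k : ℝ) (κ : Fin m → ℝ) (n₀ : ℕ) (cp cm : Fin m → ℤ → ℂ) (y : ℝ) (j : Fin m) : ℂ :=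
  (k : ℂ) / 2 * maassFun k κ n₀ cp cm (y * Complex.I) j -
    2 * Real.pi * y * maassFun k κ n₀ (derivCoeff κ cp) (derivCoeff κ cm) (y * Complex.I) j

include hκ h in
lemma Ldeltaf_eq_integral (k : ℝ) {φ : ℝ → ℂ} (hφ : IsCompactIntegrable φ) (j : Fin m) :
    Ldeltaf k κ n₀ cp cm φ j = ∫ y in Ioi (0 : ℝ), deltaFun k κ n₀ cp cm y j * φ y := by
  have h' := h.deriv hκ
  have e := tsum_laplace_eq_integral hκ h' k (hφ.twist 2) j (ψ := twist φ (3 - k))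
    fun y hy => by
      have hy0 : (y : ℂ) ≠ 0 := by exact_mod_cast hy.ne'
      rw [twist, twist, twist, mul_assoc, ← Complex.cpow_add _ _ hy0]
      congr 2
      ring
  have i1 : IntegrableOn (fun y : ℝ => (k : ℂ) / 2 *
      (maassFun k κ n₀ cp cm (y * Complex.I) j * φ y)) (Ioi 0) :=
    (hφ.continuousOn_mul (continuousOn_maassFun_mul_I hκ h k j)).1.const_mul _
  have i2 : IntegrableOn (fun y : ℝ => 2 * Real.pi *
      (maassFun k κ n₀ (derivCoeff κ cp) (derivCoeff κ cm) (y * Complex.I) j * twist φ 2 y))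
        (Ioi 0) :=
    ((hφ.twist 2).continuousOn_mul (continuousOn_maassFun_mul_I hκ h' k j)).1.const_mul _
  rw [Ldeltaf, Lf_eq_integral hκ h k hφ, sub_sub, ← mul_add]
  refine (congrArg (fun t => (k : ℂ) / 2 *
    (∫ y in Ioi (0 : ℝ), maassFun k κ n₀ cp cm (y * Complex.I) j * φ y) -
      2 * Real.pi * t) e).trans ?_
  rw [← integral_const_mul, ← integral_const_mul, ← integral_sub i1 i2]
  refine setIntegral_congr_fun measurableSet_Ioi fun y hy => ?_
  have : (y : ℂ) ^ ((2 : ℂ) - 1) = y := by norm_num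
  simp only [deltaFun, twist, this]
  ring

end Maass

/-! ### Functional equations and modularity -/

/-- After $y\mapsto1/y$ each component says that a fixed continuous function integrates to zero
against the whole test space. It is stated for a general $P$ because it is applied both to $f(iy)$
and to $(\delta_kf)(iy)$. -/
lemma functional_equation_pointwise {m : ℕ} {Sc : Set (ℝ → ℂ)} (hSc : IsTestSpace Sc) (k : ℝ)
    (χ : Matrix.SpecialLinearGroup (Fin 2) ℤ → ℂ) (R : Matrix (Fin m) (Fin m) ℂ) (a : ℂ)
    {P : ℝ → Fin m → ℂ} (hP : ∀ j, ContinuousOn (fun y => P y j) (Ioi 0))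
    (h : ∀ φ ∈ Sc, (fun j => ∫ y in Ioi (0 : ℝ), P y j * φ y) =
      a • R.mulVec fun j => ∫ y in Ioi (0 : ℝ), P y j * testSlash k χ φ y) {y : ℝ} (hy : 0 < y) :
    P y = (a * χ ModularGroup.S * ((y ^ (-k) : ℝ) : ℂ)) • R.mulVec (P y⁻¹) := by
  have hPinv : ∀ j, ContinuousOn (fun y => P y⁻¹ j) (Ioi 0) := fun j =>
    (hP j).comp (continuousOn_inv₀.mono fun y (hy : 0 < y) => hy.ne') fun y (hy : 0 < y) =>
      inv_pos.2 hy
  have hQ : ∀ j, ContinuousOn (fun y => χ ModularGroup.S * ((y ^ (-k) : ℝ) : ℂ) * P y⁻¹ j)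
      (Ioi 0) := fun j =>
    (continuousOn_const.mul (continuousOn_rpow_ofReal (-k))).mul (hPinv j)
  funext j
  have hG : ContinuousOn (fun y => P y j - ∑ l, a * R j l *
      (χ ModularGroup.S * ((y ^ (-k) : ℝ) : ℂ) * P y⁻¹ l)) (Ioi 0) :=
    (hP j).sub (continuousOn_finsetSum _ fun l _ => continuousOn_const.mul (hQ l))
  have := hSc.eq_zero_of_integral_eq_zero hG (fun φ hφ => ?_) hy
  · rw [sub_eq_zero] at this
    rw [this, Pi.smul_apply, Matrix.mulVec, dotProduct, smul_eq_mul, Finset.mul_sum]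
    exact Finset.sum_congr rfl fun l _ => by ring
  · have hφi := (hSc.isTestFunction φ hφ).isCompactIntegrable
    have h1 := congrFun (h φ hφ) j
    simp only [integral_mul_testSlash, Pi.smul_apply, Matrix.mulVec, dotProduct, smul_eq_mul] at h1
    have i2 : ∀ l, IntegrableOn (fun y : ℝ => a * R j l *
        (χ ModularGroup.S * ((y ^ (-k) : ℝ) : ℂ) * P y⁻¹ l * φ y)) (Ioi 0) := fun l =>
      (hφi.continuousOn_mul (hQ l)).1.const_mul _
    simp_rw [sub_mul, Finset.sum_mul, mul_assoc (a * R j _)]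
    rw [integral_sub (hφi.continuousOn_mul (hP j)).1 (integrable_finsetSum _ fun l _ => i2 l),
      integral_finsetSum _ fun l _ => i2 l, h1, Finset.mul_sum, sub_eq_zero]
    refine Finset.sum_congr rfl fun l _ => ?_
    rw [integral_const_mul]
    ring

/-! ### Transformation laws and generators of the modular group -/

section Modular

variable {m : ℕ} {k : ℝ} {χ : Matrix.SpecialLinearGroup (Fin 2) ℤ → ℂ}
  (ρ : Matrix.SpecialLinearGroup (Fin 2) ℤ →* Matrix.unitaryGroup (Fin m) ℂ)

/-- `f(γτ) = χ(γ) (cτ + d)^k ρ(γ) f(τ)`. -/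
def Transforms (k : ℝ) (χ : Matrix.SpecialLinearGroup (Fin 2) ℤ → ℂ)
    (ρ : Matrix.SpecialLinearGroup (Fin 2) ℤ →* Matrix.unitaryGroup (Fin m) ℂ)
    (f : UpperHalfPlane → Fin m → ℂ) (γ : Matrix.SpecialLinearGroup (Fin 2) ℤ) : Prop :=
  ∀ τ, f (γ • τ) = (χ γ * autFactor k γ τ) • (ρ γ).1.mulVec (f τ)

lemma autFactor_one (k : ℝ) (τ : UpperHalfPlane) : autFactor k 1 τ = 1 := by
  simp [autFactor]

lemma IsMultiplierSystem.map_one (hχ : IsMultiplierSystem k χ) : χ 1 = 1 := by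
  have h0 : χ 1 ≠ 0 := fun h => by simpa [h] using hχ.norm_eq_one 1
  have h := hχ.consistency 1 1 UpperHalfPlane.I
  rw [mul_one, one_smul, autFactor_one, mul_one, mul_one, mul_one] at h
  exact (mul_eq_left₀ h0).1 h.symm

/-- This is the cocycle relation for $\gamma^{-1}\gamma=1$. It shows that the automorphy factor
never vanishes and identifies its inverse. -/
lemma IsMultiplierSystem.factor_inv_mul (hχ : IsMultiplierSystem k χ)
    (γ : Matrix.SpecialLinearGroup (Fin 2) ℤ) (τ : UpperHalfPlane) :
    (χ γ⁻¹ * autFactor k γ⁻¹ (γ • τ)) * (χ γ * autFactor k γ τ) = 1 := by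
  have h := hχ.consistency γ⁻¹ γ τ
  rw [inv_mul_cancel, hχ.map_one, autFactor_one] at h
  linear_combination -h

lemma unitary_inv_mulVec (U : Matrix.unitaryGroup (Fin m) ℂ) (v : Fin m → ℂ) :
    (U⁻¹ : Matrix.unitaryGroup (Fin m) ℂ).1.mulVec (U.1.mulVec v) = v := by
  rw [Matrix.mulVec_mulVec]
  have : (U⁻¹).1 * U.1 = 1 := congrArg Subtype.val (inv_mul_cancel U)
  rw [this, Matrix.one_mulVec]

variable {ρ}

lemma transforms_one (hχ : IsMultiplierSystem k χ) (f : UpperHalfPlane → Fin m → ℂ) :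
    Transforms k χ ρ f 1 := fun τ => by
  rw [one_smul, autFactor_one, hχ.map_one, map_one]
  simp

lemma Transforms.mul (hχ : IsMultiplierSystem k χ) {f : UpperHalfPlane → Fin m → ℂ}
    {γ₁ γ₂ : Matrix.SpecialLinearGroup (Fin 2) ℤ} (h₁ : Transforms k χ ρ f γ₁)
    (h₂ : Transforms k χ ρ f γ₂) : Transforms k χ ρ f (γ₁ * γ₂) := fun τ => by
  have : (ρ (γ₁ * γ₂)).1 = (ρ γ₁).1 * (ρ γ₂).1 := by rw [map_mul]; rfl
  rw [mul_smul, h₁, h₂, this, ← Matrix.mulVec_mulVec, Matrix.mulVec_smul, smul_smul,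
    hχ.consistency γ₁ γ₂ τ]
  congr 1
  ring

lemma Transforms.inv (hχ : IsMultiplierSystem k χ) {f : UpperHalfPlane → Fin m → ℂ}
    {γ : Matrix.SpecialLinearGroup (Fin 2) ℤ} (h : Transforms k χ ρ f γ) :
    Transforms k χ ρ f γ⁻¹ := fun τ => by
  have h1 := h (γ⁻¹ • τ)
  have h2 := hχ.factor_inv_mul γ (γ⁻¹ • τ)
  rw [smul_inv_smul] at h1 h2
  rw [h1, Matrix.mulVec_smul, map_inv, unitary_inv_mulVec, smul_smul, h2, one_smul]

lemma transforms_of_generators (hχ : IsMultiplierSystem k χ) {f : UpperHalfPlane → Fin m → ℂ}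
    (hS : Transforms k χ ρ f ModularGroup.S) (hT : Transforms k χ ρ f ModularGroup.T)
    (γ : Matrix.SpecialLinearGroup (Fin 2) ℤ) : Transforms k χ ρ f γ := by
  let G : Subgroup (Matrix.SpecialLinearGroup (Fin 2) ℤ) :=
    { carrier := {γ | Transforms k χ ρ f γ}
      one_mem' := transforms_one hχ f
      mul_mem' := fun h₁ h₂ => h₁.mul hχ h₂
      inv_mem' := fun h => h.inv hχ }
  have : Subgroup.closure {ModularGroup.S, ModularGroup.T} ≤ G := by
    rw [Subgroup.closure_le]
    rintro γ (rfl | rfl)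
    · exact hS
    · exact hT
  rw [SpecialLinearGroup.SL2Z_generators] at this
  exact this (Subgroup.mem_top γ)

lemma Transforms.slash_eq (hχ : IsMultiplierSystem k χ) {f : UpperHalfPlane → Fin m → ℂ}
    {γ : Matrix.SpecialLinearGroup (Fin 2) ℤ} (h : Transforms k χ ρ f γ) :
    slash k χ ρ f γ = f := by
  funext τ
  have h0 : χ γ * autFactor k γ τ ≠ 0 := right_ne_zero_of_mul_eq_one (hχ.factor_inv_mul γ τ)
  have h1 : autFactor (-k) γ τ = (autFactor k γ τ)⁻¹ := by
    rw [autFactor, autFactor, Complex.ofReal_neg, Complex.cpow_neg]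
  rw [slash, h τ, Matrix.mulVec_smul, unitary_inv_mulVec, smul_smul, h1, ← mul_inv_rev,
    inv_mul_cancel₀ h0, one_smul]

end Modular

/-! ### The laws under $T$ and $S$ for the given series -/

section MainResult

variable {m : ℕ} {k : ℝ} {χ : Matrix.SpecialLinearGroup (Fin 2) ℤ → ℂ}
  {ρ : Matrix.SpecialLinearGroup (Fin 2) ℤ →* Matrix.unitaryGroup (Fin m) ℂ}
  {κ : Fin m → ℝ} {n₀ : ℕ} {cp cm : Fin m → ℤ → ℂ}

lemma transforms_T
    (hT : ∀ j, χ ModularGroup.T • Matrix.mulVec (ρ ModularGroup.T).1 (Pi.single j 1) =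
      Complex.exp (2 * Real.pi * Complex.I * (κ j : ℂ)) • (Pi.single j 1 : Fin m → ℂ)) :
    Transforms k χ ρ (maassSeries k κ n₀ cp cm) ModularGroup.T := by
  intro τ
  have e1 : ((ModularGroup.T • τ : UpperHalfPlane) : ℂ) = τ + 1 := by
    rw [UpperHalfPlane.modular_T_smul, UpperHalfPlane.coe_vadd]
    push_cast
    ring
  have e2 : autFactor k ModularGroup.T τ = 1 := by
    simp [autFactor, ModularGroup.T]
  funext j
  -- The eigenvector hypothesis makes $\chi(T)\rho(T)$ diagonal, with the same entries $e^{2\pi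
  -- i\kappa_j}$ that the Fourier expansion acquires under $\tau\mapsto\tau+1$.
  have e3 : ∀ l, χ ModularGroup.T * (ρ ModularGroup.T).1 j l =
      if j = l then Complex.exp (2 * Real.pi * Complex.I * (κ l : ℂ)) else 0 := fun l => by
    have := congrFun (hT l) j
    simpa [Matrix.mulVec_single, Pi.single_apply] using this
  rw [maassSeries_eq, maassSeries_eq, e1, maassFun_add_one, e2, mul_one, Pi.smul_apply,
    Matrix.mulVec, dotProduct, smul_eq_mul, Finset.mul_sum]
  simp_rw [← mul_assoc, e3]
  simp

lemma ofReal_mul_I_cpow {y : ℝ} (hy : 0 < y) (s : ℂ) :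
    ((y : ℂ) * Complex.I) ^ s = (y : ℂ) ^ s * Complex.I ^ s := by
  have hy0 : (y : ℂ) ≠ 0 := by exact_mod_cast hy.ne'
  rw [Complex.cpow_def_of_ne_zero (mul_ne_zero hy0 Complex.I_ne_zero),
    Complex.cpow_def_of_ne_zero hy0, Complex.cpow_def_of_ne_zero Complex.I_ne_zero,
    Complex.log_ofReal_mul hy Complex.I_ne_zero, ← Complex.exp_add, Complex.ofReal_log hy.le,
    add_mul]

lemma transforms_S (hκ : ∀ j, 0 ≤ κ j ∧ κ j < 1) (h : SubexpCoeffs κ n₀ cp cm)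
    {Sc : Set (ℝ → ℂ)} (hSc : IsTestSpace Sc)
    (hL : ∀ φ ∈ Sc, Lf k κ n₀ cp cm φ = Complex.I ^ (k : ℂ) •
      Matrix.mulVec (ρ ModularGroup.S).1 (Lf k κ n₀ cp cm (testSlash k χ φ)))
    (hLdelta : ∀ φ ∈ Sc, Ldeltaf k κ n₀ cp cm φ = (-Complex.I ^ (k : ℂ)) •
      Matrix.mulVec (ρ ModularGroup.S).1 (Ldeltaf k κ n₀ cp cm (testSlash k χ φ))) :
    Transforms k χ ρ (maassSeries k κ n₀ cp cm) ModularGroup.S := by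
  set F := maassFun k κ n₀ cp cm with hF
  set F' := maassFun k κ n₀ (derivCoeff κ cp) (derivCoeff κ cm) with hF'
  let M : (Fin m → ℂ) →L[ℂ] (Fin m → ℂ) :=
    χ ModularGroup.S • LinearMap.toContinuousLinearMap (Matrix.mulVecLin (ρ ModularGroup.S).1)
  have hM : ∀ v, M v = χ ModularGroup.S • (ρ ModularGroup.S).1.mulVec v := fun v => rfl
  have him : ∀ {y : ℝ}, 0 < y → 0 < ((y : ℂ) * Complex.I).im := fun hy => by simpa using hy
  have hinv : ∀ y : ℝ, -((y : ℂ) * Complex.I)⁻¹ = ((y⁻¹ : ℝ) : ℂ) * Complex.I := fun y => by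
    rw [mul_inv, Complex.inv_I]; push_cast; ring
  -- Principal powers are multiplicative here because $y>0$; the factor $i^k$ of the functional
  -- equation thus combines with $y^k$ into $(iy)^k$.
  have hcpow : ∀ {y : ℝ}, 0 < y →
      ((y : ℂ) * Complex.I) ^ (k : ℂ) = Complex.I ^ (k : ℂ) * (((y⁻¹) ^ (-k) : ℝ) : ℂ) := by
    intro y hy
    rw [ofReal_mul_I_cpow hy, Real.inv_rpow hy.le, Real.rpow_neg hy.le, inv_inv,
      Complex.ofReal_cpow hy.le, mul_comm]
  have hf0 : ∀ y : ℝ, 0 < y → F (-(y * Complex.I)⁻¹) =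
      (y * Complex.I) ^ (k : ℂ) • M (F (y * Complex.I)) := by
    intro y hy
    have := functional_equation_pointwise hSc k χ (ρ ModularGroup.S).1 (Complex.I ^ (k : ℂ))
      (P := fun y => F (y * Complex.I)) (continuousOn_maassFun_mul_I hκ h k) (fun φ hφ => ?_)
      (inv_pos.2 hy)
    · rw [hinv, this, inv_inv, hM, hcpow hy, smul_smul]
      congr 1
      ring
    · have hφi := (hSc.isTestFunction φ hφ).isCompactIntegrable
      have h1 := hL φ hφ
      rwa [funext (Lf_eq_integral hκ h k hφi), funext (Lf_eq_integral hκ h k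
        (hφi.testSlash k χ))] at h1
  have hdelta : ∀ y : ℝ, 0 < y → deltaFun k κ n₀ cp cm y⁻¹ =
      -(((y : ℂ) * Complex.I) ^ (k : ℂ) • M (deltaFun k κ n₀ cp cm y)) := by
    intro y hy
    have := functional_equation_pointwise hSc k χ (ρ ModularGroup.S).1 (-Complex.I ^ (k : ℂ))
      (P := deltaFun k κ n₀ cp cm) (fun j => ?_) (fun φ hφ => ?_) (inv_pos.2 hy)
    · rw [this, inv_inv, hM, hcpow hy, smul_smul, ← neg_smul]
      congr 1
      ring
    · exact (continuousOn_const.mul (continuousOn_maassFun_mul_I hκ h k j)).sub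
        ((continuousOn_const.mul Complex.continuous_ofReal.continuousOn).mul
          (continuousOn_maassFun_mul_I hκ (h.deriv hκ) k j))
    · have hφi := (hSc.isTestFunction φ hφ).isCompactIntegrable
      have h1 := hLdelta φ hφ
      rwa [funext (Ldeltaf_eq_integral hκ h k hφi), funext (Ldeltaf_eq_integral hκ h k
        (hφi.testSlash k χ))] at h1
  have hdeltaFun : ∀ y : ℝ, deltaFun k κ n₀ cp cm y = ((k : ℂ) / 2) • F (y * Complex.I) -
      (2 * Real.pi * y : ℂ) • F' (y * Complex.I) := fun y => rfl
  have hinversion := fun z hz => inversion_formula_of_imaginary_axis k M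
    (fun z hz => (analyticAt_maassFun hκ h k hz).differentiableAt)
    (fun z hz => differentiableAt_shadow hκ h k hz)
    (fun z hz => barPart_fderiv_maassFun hκ h k hz) hf0 (fun y hy => by
      have hy0 : (y : ℂ) ≠ 0 := by exact_mod_cast hy.ne'
      have h1 := hdelta y hy
      rw [hdeltaFun, hdeltaFun, ← hinv, hf0 y hy, map_sub, map_smul, map_smul] at h1
      rw [fderiv_maassFun_one hκ h k (him hy), fderiv_maassFun_one hκ h k
        (im_neg_inv_pos (him hy)), Complex.cpow_sub _ _ (mul_ne_zero hy0 Complex.I_ne_zero),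
        Complex.cpow_one, map_smul]
      rw [← hF'] at *
      generalize ((y : ℂ) * Complex.I) ^ (k : ℂ) = E at *
      generalize M (F (y * Complex.I)) = v at *
      generalize M (F' (y * Complex.I)) = v' at *
      generalize F' (-((y : ℂ) * Complex.I)⁻¹) = u at *
      -- Solve the equation for $\delta_kf$ for the $u$-derivative at $i/y$. Because of its minus
      -- sign, the two contributions $\frac k2(iy)^kMf(iy)$ add up to the term $k$ that
      -- differentiating $z^k$ produces.
      have h2 : u = ((2 * Real.pi * ((y⁻¹ : ℝ) : ℂ) : ℂ)⁻¹) •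
          ((k : ℂ) • E • v - (2 * Real.pi * y : ℂ) • E • v') := by
        have hne : (2 * Real.pi * ((y⁻¹ : ℝ) : ℂ) : ℂ) ≠ 0 := by
          have : 2 * Real.pi * y⁻¹ ≠ 0 := by positivity
          exact_mod_cast this
        rw [eq_inv_smul_iff₀ hne]
        have h3 := sub_eq_iff_eq_add.1 h1
        have h4 : (2 * Real.pi * ((y⁻¹ : ℝ) : ℂ) : ℂ) • u = ((k : ℂ) / 2) • E • v +
            E • (((k : ℂ) / 2) • v - (2 * Real.pi * y : ℂ) • v') := by
          rw [h3]; module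
        rw [h4]
        module
      rw [h2]
      have hpi : (Real.pi : ℂ) ≠ 0 := by exact_mod_cast Real.pi_ne_zero
      push_cast
      match_scalars
      · field_simp
        linear_combination -(k * E : ℂ) * Complex.I_sq
      · field_simp) (z := z) hz
  intro τ
  have e1 : ((ModularGroup.S • τ : UpperHalfPlane) : ℂ) = -(τ : ℂ)⁻¹ := by
    rw [UpperHalfPlane.modular_S_smul]
    exact inv_neg
  have e2 : autFactor k ModularGroup.S τ = (τ : ℂ) ^ (k : ℂ) := by
    simp [autFactor, ModularGroup.S]
  rw [maassSeries_eq, maassSeries_eq, e1, e2, hinversion _ τ.im_pos, hM, smul_smul, mul_comm]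

end MainResult

end VVMaass

end

theorem mainTheorem2 {m : ℕ} (k : ℝ) (hk : ∃ N : ℤ, k = (N : ℝ) / 2)
    (χ : Matrix.SpecialLinearGroup (Fin 2) ℤ → ℂ) (hχ : VVMaass.IsMultiplierSystem k χ)
    (ρ : Matrix.SpecialLinearGroup (Fin 2) ℤ →* Matrix.unitaryGroup (Fin m) ℂ)
    (κ : Fin m → ℝ) (hκ : ∀ j, 0 ≤ κ j ∧ κ j < 1)
    (hT : ∀ j, χ ModularGroup.T • Matrix.mulVec (ρ ModularGroup.T).1 (Pi.single j 1) =
      Complex.exp (2 * Real.pi * Complex.I * (κ j : ℂ)) • (Pi.single j 1 : Fin m → ℂ))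
    (n₀ : ℕ) (cp cm : Fin m → ℤ → ℂ)
    (hgrowth : ∃ C : ℝ, 0 < C ∧ ∀ j,
      (cp j =O[Filter.atTop] fun n : ℤ => Real.exp (C * Real.sqrt |(n : ℝ)|)) ∧
      (cm j =O[Filter.atBot] fun n : ℤ => Real.exp (C * Real.sqrt |(n : ℝ)|)))
    (Sc : Set (ℝ → ℂ)) (hSc : VVMaass.IsTestSpace Sc)
    (hL : ∀ φ ∈ Sc,
      VVMaass.Lf k κ n₀ cp cm φ =
        Complex.I ^ (k : ℂ) • Matrix.mulVec (ρ ModularGroup.S).1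
          (VVMaass.Lf k κ n₀ cp cm (VVMaass.testSlash k χ φ)))
    (hLdelta : ∀ φ ∈ Sc,
      VVMaass.Ldeltaf k κ n₀ cp cm φ =
        (-Complex.I ^ (k : ℂ)) • Matrix.mulVec (ρ ModularGroup.S).1
          (VVMaass.Ldeltaf k κ n₀ cp cm (VVMaass.testSlash k χ φ))) :
    VVMaass.IsHarmonicWeakMaassForm k χ ρ κ (VVMaass.maassSeries k κ n₀ cp cm) := by
  obtain ⟨C, -, hC⟩ := hgrowth
  have h : VVMaass.SubexpCoeffs κ n₀ cp cm :=
    ⟨fun j => VVMaass.subexp_holFreq n₀ (hκ j).1 (hC j).1,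
      fun j => VVMaass.subexp_nonholFreq (hκ j).1 (hC j).2⟩
  -- Analyticity and the Laplacian depend only on germs, so they can be computed for the series as a
  -- function on $\mathbb C$, whatever `UpperHalfPlane.ofComplex` does outside the half plane.
  have hofc : ∀ z : ℂ, 0 < z.im →
      (fun z : ℂ => VVMaass.maassSeries k κ n₀ cp cm (UpperHalfPlane.ofComplex z)) =ᶠ[nhds z]
        VVMaass.maassFun k κ n₀ cp cm := by
    intro z hz
    filter_upwards [(isOpen_lt continuous_const Complex.continuous_im).mem_nhds hz] with w hw
    rw [VVMaass.maassSeries_eq, UpperHalfPlane.ofComplex_apply_of_im_pos hw]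
  refine ⟨fun z hz => (VVMaass.analyticAt_maassFun hκ h k hz).congr (hofc z hz).symm, fun γ => ?_,
    fun z hz => VVMaass.laplacian_eq_zero k
      (fun z hz => VVMaass.differentiableAt_shadow hκ h k hz) (fun z hz => ?_) hz, ?_⟩
  · exact (VVMaass.transforms_of_generators hχ (VVMaass.transforms_S hκ h hSc hL hLdelta)
      (VVMaass.transforms_T hT) γ).slash_eq hχ
  · rw [(hofc z hz).fderiv_eq, VVMaass.barPart_fderiv_maassFun hκ h k hz]
  · refine ⟨n₀, cp, cm, fun τ => ⟨fun j => ?_, fun j => ?_, rfl⟩⟩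
    · simp_rw [VVMaass.holTerm_eq]
      exact VVMaass.summable_holSeries (VVMaass.freqSummable_holFreq n₀ (hκ j).1) (h.hol j)
        τ.im_pos
    · simp_rw [VVMaass.nonholTerm_eq]
      exact VVMaass.summable_nonholSeries (VVMaass.nonholFreq_pos_bound hκ j)
        (VVMaass.le_nonholFreq (hκ j).1) (VVMaass.freqSummable_nonholFreq (hκ j).1) (h.nonhol j)
        τ.im_pos
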